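/- A set $\Gamma\subset\mathbb R$ is separated if $\inf_{\gamma\neq\gamma'}|\gamma-\gamma'|>0$ over $\gamma,\gamma'\in\Gamma$. Its lower and upper uniform densities are $$D^-(\Gamma)=\lim_{R\to\infty}\inf_{x\in\mathbb R}\frac{\#(\Gamma\cap[x-R,x+R])}{2R},\qquad D^+(\Gamma)=\lim_{R\to\infty}\sup_{x\in\mathbb R}\frac{\#(\Gamma\cap[x-R,x+R])}{2R}.$$ Let $\alpha>0$ and let $\mathcal G(z)=P(e^{\alpha z})/Q(e^{\alpha z})$, where $P,Q$ are complex polynomials without common zeros such that $1\le\deg P<\deg Q$, $P(0)=0$ and $Q(x)\neq0$ for all real $x\ge0$. Put $q(\mathcal G)=\deg Q$, and let $k(\mathcal G)$ be the greatest integer $k$ for which there is a constant $c\in\mathbb C$ with $\mathcal G(z+2\pi i/(k\alpha))=c\,\mathcal G(z)$ as meromorphic functions of $z\in\mathbb C$. For a separated set $\Gamma$ and $p\in[1,\infty]$ let $V^p_\Gamma(\mathcal G)$ be the space of all functions $f(x)=\sum_{\gamma\in\Gamma}c_\gamma\,\mathcal G(x-\gamma)$, $x\in\mathbb R$, with $(c_\gamma)\in\ell^p(\Gamma)$.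 The $\Gamma$-shifts of $\mathcal G$ are called stable if for every $p\in[1,\infty]$ there are constants $C_1,C_2>0$ such that $$C_1\|c\|_{\ell^p(\Gamma)}\le\Big\|\sum_{\gamma\in\Gamma}c_\gamma\,\mathcal G(\cdot-\gamma)\Big\|_{L^p(\mathbb R)}\le C_2\|c\|_{\ell^p(\Gamma)}\qquad\text{for all }c\in\ell^p(\Gamma).$$ **Corollary.** Let $\Lambda,\Gamma\subset\mathbb R$ be separated sets with $D^-(\Gamma)>0$. Assume that the $\Gamma$-shifts of $\mathcal G$ are stable and that $$D^-(\Lambda)>\frac{q(\mathcal G)}{k(\mathcal G)}\,D^+(\Gamma).$$ Then for every $p\in[1,\infty]$ the set $\Gamma$ is an interpolation set for $V^p_\Lambda(\mathcal G)$: for every $(a_\gamma)\in\ell^p(\Gamma)$ there is $f\in V^p_\Lambda(\mathcal G)$ such that $f(\gamma)=a_\gamma$ for all $\gamma\in\Gamma$. -/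

import Mathlib

open MeasureTheory Filter Set
open scoped ENNReal

namespace ShiftInvariant

/-- `Γ ⊆ ℝ` is separated: distinct points keep a positive distance. -/
def Separated (Γ : Set ℝ) : Prop :=
  ∃ δ : ℝ, 0 < δ ∧ ∀ x ∈ Γ, ∀ y ∈ Γ, x ≠ y → δ ≤ |x - y|

/-- Lower uniform (Beurling) density. It takes values in `[0, ∞]`; for a separated set the limit
as `R → ∞` exists and is finite, so that the lower limit is the limit. -/
noncomputable def lowerDensity (Γ : Set ℝ) : ℝ≥0∞ :=
  liminf (fun R : ℝ =>
    ⨅ x : ℝ, ((Γ ∩ Icc (x - R) (x + R)).encard : ℝ≥0∞) / ENNReal.ofReal (2 * R)) atTop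

/-- Upper uniform (Beurling) density. It takes values in `[0, ∞]`; for a separated set the limit
as `R → ∞` exists and is finite, so that the upper limit is the limit. -/
noncomputable def upperDensity (Γ : Set ℝ) : ℝ≥0∞ :=
  limsup (fun R : ℝ =>
    ⨆ x : ℝ, ((Γ ∩ Icc (x - R) (x + R)).encard : ℝ≥0∞) / ENNReal.ofReal (2 * R)) atTop

/-- The generator `G(z) = P(e^{αz}) / Q(e^{αz})` (a meromorphic function; the value that Lean
assigns at a pole is never used). -/
noncomputable def generator (α : ℝ) (P Q : Polynomial ℂ) (z : ℂ) : ℂ :=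
  P.eval (Complex.exp (α * z)) / Q.eval (Complex.exp (α * z))

/-- The conditions on `P`, `Q` under which `generator α P Q`, `α > 0`, is in the class `K(α)`. -/
structure IsClassK (P Q : Polynomial ℂ) : Prop where
  no_common_zero : ∀ z : ℂ, ¬ (P.eval z = 0 ∧ Q.eval z = 0)
  one_le_deg : 1 ≤ P.natDegree
  deg_lt_deg : P.natDegree < Q.natDegree
  eval_zero : P.eval 0 = 0
  no_zero_nonneg : ∀ x : ℝ, 0 ≤ x → Q.eval (x : ℂ) ≠ 0

/-- `G(z + 2πi/(kα)) = c G(z)` for some constant `c`, as an equality of meromorphic functions,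
i.e. at every `z` at which neither side has a pole. -/
def HasSymmetryOrder (α : ℝ) (P Q : Polynomial ℂ) (k : ℕ) : Prop :=
  1 ≤ k ∧ ∃ c : ℂ, ∀ z : ℂ,
    Q.eval (Complex.exp (α * z)) ≠ 0 →
    Q.eval (Complex.exp (α * (z + 2 * Real.pi * Complex.I / (k * α)))) ≠ 0 →
    generator α P Q (z + 2 * Real.pi * Complex.I / (k * α)) = c * generator α P Q z

/-- `k(G)`: the greatest `k` with the above symmetry. For `P`, `Q` as in `IsClassK` the set
contains `1` and is bounded by `deg Q`, since rotation by `2π/k` permutes the nonzero poles. -/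
noncomputable def symmetryOrder (α : ℝ) (P Q : Polynomial ℂ) : ℕ :=
  sSup {k : ℕ | HasSymmetryOrder α P Q k}

/-- The `Γ`-shifts of `G` are stable: for every `p ∈ [1, ∞]` they are `ℓ^p`-stable. -/
def StableShifts (G : ℂ → ℂ) (Γ : Set ℝ) : Prop :=
  ∀ p : ℝ≥0∞, 1 ≤ p → ∃ C₁ C₂ : ℝ, 0 < C₁ ∧ 0 < C₂ ∧
    ∀ c : lp (fun _ : Γ => ℂ) p,
      ENNReal.ofReal (C₁ * ‖c‖)
          ≤ eLpNorm (fun x : ℝ => ∑' γ : Γ, c γ * G ((x - γ : ℝ) : ℂ)) p volume ∧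
      eLpNorm (fun x : ℝ => ∑' γ : Γ, c γ * G ((x - γ : ℝ) : ℂ)) p volume
          ≤ ENNReal.ofReal (C₂ * ‖c‖)

/-- The quasi shift-invariant space `V^p_Γ(G)`: all functions `∑ c_γ G(· - γ)`, `c ∈ ℓ^p(Γ)`. -/
def quasiShiftSpace (G : ℂ → ℂ) (Γ : Set ℝ) (p : ℝ≥0∞) : Set (ℝ → ℂ) :=
  {f | ∃ c : lp (fun _ : Γ => ℂ) p,
    ∀ x : ℝ, HasSum (fun γ : Γ => c γ * G ((x - γ : ℝ) : ℂ)) (f x)}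

/-- `Λ` is a set of interpolation for a space `V` of functions on `ℝ`, with data in `ℓ^p(Λ)`. -/
def IsInterpolationSet (Λ : Set ℝ) (V : Set (ℝ → ℂ)) (p : ℝ≥0∞) : Prop :=
  ∀ a : lp (fun _ : Λ => ℂ) p, ∃ f ∈ V, ∀ t : Λ, f t = a t

end ShiftInvariant

namespace ShiftInvariant

/-! Interpolation on `Γ` asks for a right inverse of the matrix `G(γ - a)`, `γ ∈ Γ`, `a ∈ Λ`. Since
`G` decays exponentially on the real line, the matrix decays exponentially off the diagonal. It is
then enough to bound its adjoint below on `ℓ²`: a Neumann series gives a right inverse whose entries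
again decay exponentially (`exists_rightInverse`), and by Schur's test this one matrix acts on every
`ℓ^p`.

The lower bound is a sampling inequality on `Λ` for `f(x) = ∑ d_γ G(γ - x)`. Stability for `p = 2`
concerns the shifts `G(x - γ)`, but reflection only transposes their Gram matrix
(`lintegral_sq_sum_reflected_shifts`), so `‖d‖` is controlled by `‖f‖₂`. It remains to control
`‖f‖₂` by the samples.

Let `r = q(G)/k(G)`. The symmetry of order `k = k(G)` forces `P = X^s P₁(X^k)` and `Q = Q₁(X^k)`
with `deg Q₁ = r`. With `κ = kα`, a sum of shifts over a finite set `S` is therefore, up to a factor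
`e^{σx}`, a polynomial in `e^{κx}` of degree less than `r|S|` over an explicit product, and Lagrange
interpolation recovers it from `r|S|` nodes. The nodes are the points of `Λ` nearest to `x`, on each
side of `x` exactly `r` times as many as `S` has there. Up to `O(1 + |x - a|)`, the logarithm of the
weight at a node `a` compares the points of `Λ` with `r` times those of `S` between `x` and `a`. The
surplus in density grows linearly with distance, so its integral is quadratic and the weight is
Gaussian in `|x - a|`. Hence `|f(x)| ≤ C ∑ e^{-|x - a|} |f(a)|` with `C` independent of `S` and `x`
(`exists_norm_sum_shifts_le`), and Cauchy–Schwarz and integration in `x` finish the argument. -/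

/-! ### Separated sets: counting and exponential sums -/

theorem Separated.neg {Γ : Set ℝ} (h : Separated Γ) : Separated (Neg.neg ⁻¹' Γ) := by
  obtain ⟨δ, hδ, h⟩ := h
  refine ⟨δ, hδ, fun x hx y hy hxy => ?_⟩
  have := h (-x) hx (-y) hy (fun h => hxy (neg_injective h))
  rwa [← abs_neg, show -(x - y) = -x - -y by ring]

/-- A cell of length `δ` cannot hold two points of `Γ`. Sums over `Γ` become sums over distinct
integers, uniformly in the base point `x`. -/
theorem injOn_floor {Γ : Set ℝ} {δ : ℝ} (hδ : 0 < δ)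
    (h : ∀ x ∈ Γ, ∀ y ∈ Γ, x ≠ y → δ ≤ |x - y|) (x : ℝ) :
    InjOn (fun γ : ℝ => ⌊(γ - x) / δ⌋) Γ := by
  intro a ha b hb hab
  by_contra hne
  have h1 := h a ha b hb hne
  have h2 := Int.abs_sub_lt_one_of_floor_eq_floor hab
  rw [← sub_div, abs_div, abs_of_pos hδ, div_lt_one hδ] at h2
  have : a - x - (b - x) = a - b := by ring
  rw [this] at h2
  linarith

theorem summable_exp_neg_mul_abs_int {a : ℝ} (ha : 0 < a) :
    Summable fun j : ℤ => Real.exp (-a * |(j : ℝ)|) := by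
  have h : Summable fun n : ℕ => Real.exp (-a * (n : ℝ)) := by
    have := summable_geometric_of_lt_one (Real.exp_pos (-a)).le
      (Real.exp_lt_one_iff.mpr (by linarith : -a < 0))
    refine this.congr fun n => ?_
    rw [← Real.exp_nat_mul, mul_comm]
  rw [summable_int_iff_summable_nat_and_neg]
  constructor
  · simpa using h
  · simpa using h

theorem Separated.exists_sum_exp_le {Γ : Set ℝ} (hΓ : Separated Γ) {b : ℝ} (hb : 0 < b) :
    ∃ C : ℝ, 0 < C ∧ ∀ (x : ℝ) (F : Finset ℝ), (↑F : Set ℝ) ⊆ Γ →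
      ∑ γ ∈ F, Real.exp (-b * |x - γ|) ≤ C := by
  obtain ⟨δ, hδ, h⟩ := hΓ
  have hs := summable_exp_neg_mul_abs_int (mul_pos hb hδ)
  -- The factor `e^{bδ}` pays for replacing `(γ - x) / δ` by its floor.
  refine ⟨Real.exp (b * δ) * ∑' j : ℤ, Real.exp (-(b * δ) * |(j : ℝ)|), ?_, fun x F hF => ?_⟩
  · exact mul_pos (Real.exp_pos _)
      (hs.tsum_pos (fun _ => (Real.exp_pos _).le) 0 (Real.exp_pos _))
  have hinj : InjOn (fun γ : ℝ => ⌊(γ - x) / δ⌋) (↑F : Set ℝ) := (injOn_floor hδ h x).mono hF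
  calc ∑ γ ∈ F, Real.exp (-b * |x - γ|)
      ≤ ∑ γ ∈ F, Real.exp (b * δ) * Real.exp (-(b * δ) * |((⌊(γ - x) / δ⌋ : ℤ) : ℝ)|) := by
        refine Finset.sum_le_sum fun γ _ => ?_
        rw [← Real.exp_add]
        apply Real.exp_le_exp.mpr
        have h1 := Int.floor_le ((γ - x) / δ)
        have h2 := Int.lt_floor_add_one ((γ - x) / δ)
        have h3 : |((⌊(γ - x) / δ⌋ : ℤ) : ℝ)| ≥ |(γ - x) / δ| - 1 := by
          have := abs_sub_abs_le_abs_sub ((γ - x) / δ) ((⌊(γ - x) / δ⌋ : ℤ) : ℝ)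
          have h4 : |(γ - x) / δ - ((⌊(γ - x) / δ⌋ : ℤ) : ℝ)| ≤ 1 := by
            rw [abs_le]; constructor <;> linarith
          linarith
        have h5 : |((⌊(γ - x) / δ⌋ : ℤ) : ℝ)| ≤ |(γ - x) / δ| + 1 := by
          have := abs_sub_abs_le_abs_sub ((⌊(γ - x) / δ⌋ : ℤ) : ℝ) ((γ - x) / δ)
          have h4 : |((⌊(γ - x) / δ⌋ : ℤ) : ℝ) - (γ - x) / δ| ≤ 1 := by
            rw [abs_le]; constructor <;> linarith
          linarith
        have h6 : |x - γ| = δ * |(γ - x) / δ| := by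
          rw [abs_div, abs_of_pos hδ, abs_sub_comm]; field_simp
        rw [h6]
        have := mul_le_mul_of_nonneg_left h5 (mul_pos hb hδ).le
        nlinarith
    _ = Real.exp (b * δ) * ∑ j ∈ F.image (fun γ : ℝ => ⌊(γ - x) / δ⌋),
          Real.exp (-(b * δ) * |(j : ℝ)|) := by
        rw [Finset.sum_image hinj, Finset.mul_sum]
    _ ≤ _ := by
        gcongr
        exact hs.sum_le_tsum _ (fun _ _ => (Real.exp_pos _).le)

theorem Separated.finite_inter_Icc {Γ : Set ℝ} (hΓ : Separated Γ) (a b : ℝ) :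
    (Γ ∩ Icc a b).Finite := by
  obtain ⟨δ, hδ, h⟩ := hΓ
  have hinj := (injOn_floor hδ h 0).mono (inter_subset_left (t := Icc a b))
  refine Set.Finite.of_finite_image ((Set.finite_Icc ⌊a / δ⌋ ⌊b / δ⌋).subset ?_) hinj
  rintro _ ⟨γ, ⟨_, h1, h2⟩, rfl⟩
  simp only [sub_zero]
  exact ⟨Int.floor_le_floor (by gcongr), Int.floor_le_floor (by gcongr)⟩

theorem Separated.exists_card_le {Γ : Set ℝ} (hΓ : Separated Γ) :
    ∃ C : ℝ, 0 < C ∧ ∀ (a b : ℝ) (F : Finset ℝ), a ≤ b → (↑F : Set ℝ) ⊆ Γ ∩ Icc a b →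
      (F.card : ℝ) ≤ C * (1 + (b - a)) := by
  obtain ⟨δ, hδ, h⟩ := hΓ
  refine ⟨1 / δ + 1, by positivity, fun a b F hab hF => ?_⟩
  have hinj := (injOn_floor hδ h a).mono (hF.trans inter_subset_left)
  have h1 : (F.image (fun γ : ℝ => ⌊(γ - a) / δ⌋)) ⊆ Finset.Icc 0 ⌊(b - a) / δ⌋ := by
    intro j hj
    obtain ⟨γ, hγ, rfl⟩ := Finset.mem_image.mp hj
    have h2 := (hF hγ).2
    rw [Finset.mem_Icc]
    refine ⟨Int.floor_nonneg.mpr (div_nonneg (by linarith [h2.1]) hδ.le),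
      Int.floor_le_floor ?_⟩
    gcongr
    exact h2.2
  have h2 := Finset.card_le_card h1
  rw [Finset.card_image_of_injOn hinj, Int.card_Icc] at h2
  have h0 : 0 ≤ (b - a) / δ := div_nonneg (by linarith) hδ.le
  have h3 : ((⌊(b - a) / δ⌋ + 1 - 0).toNat : ℝ) = ⌊(b - a) / δ⌋ + 1 := by
    have : (0 : ℤ) ≤ ⌊(b - a) / δ⌋ + 1 - 0 := by have := Int.floor_nonneg.mpr h0; omega
    have h4 := Int.toNat_of_nonneg this
    have : (((⌊(b - a) / δ⌋ + 1 - 0).toNat : ℤ) : ℝ) = ((⌊(b - a) / δ⌋ + 1 - 0 : ℤ) : ℝ) := by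
      rw [h4]
    push_cast at this
    simpa using this
  have h4 : (F.card : ℝ) ≤ ⌊(b - a) / δ⌋ + 1 := by rw [← h3]; exact_mod_cast h2
  have h5 := Int.floor_le ((b - a) / δ)
  have h6 : (b - a) / δ = 1 / δ * (b - a) := by ring
  have h7 : 0 < 1 / δ := by positivity
  nlinarith

theorem Separated.summable_exp {Γ : Set ℝ} (hΓ : Separated Γ) {b : ℝ} (hb : 0 < b) (x : ℝ) :
    Summable fun γ : Γ => Real.exp (-b * |x - γ|) := by
  obtain ⟨C, -, hC⟩ := hΓ.exists_sum_exp_le hb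
  refine summable_of_sum_le (c := C) (fun _ => (Real.exp_pos _).le) fun u => ?_
  have := hC x (u.map (Function.Embedding.subtype _)) (by intro y; simp; tauto)
  simpa using this

theorem Separated.exists_tsum_exp_le {Γ : Set ℝ} (hΓ : Separated Γ) {b : ℝ} (hb : 0 < b) :
    ∃ C : ℝ, 0 < C ∧ ∀ x : ℝ, ∑' γ : Γ, Real.exp (-b * |x - γ|) ≤ C := by
  obtain ⟨C, hC0, hC⟩ := hΓ.exists_sum_exp_le hb
  refine ⟨C, hC0, fun x => (hΓ.summable_exp hb x).tsum_le_of_sum_le fun u => ?_⟩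
  have := hC x (u.map (Function.Embedding.subtype _)) (by intro y; simp; tauto)
  simpa using this

theorem Separated.countable {Γ : Set ℝ} (hΓ : Separated Γ) : Countable Γ := by
  have := (hΓ.summable_exp one_pos 0).countable_support
  have h2 : Function.support (fun γ : Γ => Real.exp (-1 * |0 - (γ : ℝ)|)) = univ := by
    ext; simp [Real.exp_ne_zero]
  rw [h2] at this
  exact countable_univ_iff.mp this

/-! ### Choice of the interpolation nodes -/

/-- `A` collects the `n` smallest points of `U`. Each step adds the least remaining point, which
exists because only finitely many lie below a given one. -/
theorem exists_initial_finset {U : Set ℝ} (hU : U.Infinite) (hfin : ∀ b, (U ∩ Iic b).Finite)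
    (n : ℕ) : ∃ A : Finset ℝ, ↑A ⊆ U ∧ A.card = n ∧ ∀ a ∈ A, ∀ u ∈ U, u ≤ a → u ∈ A := by
  induction n with
  | zero => exact ⟨∅, by simp⟩
  | succ n ih =>
    obtain ⟨A, hAU, hA, hin⟩ := ih
    obtain ⟨u₀, hu₀, hu₀A⟩ := hU.exists_notMem_finset A
    obtain ⟨m, ⟨⟨hmU, hmu⟩, hmA⟩, hmin⟩ := Set.exists_min_image ((U ∩ Iic u₀) \ ↑A) id
      ((hfin u₀).sdiff) ⟨u₀, ⟨hu₀, le_refl u₀⟩, hu₀A⟩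
    refine ⟨insert m A, ?_, ?_, ?_⟩
    · intro y hy
      rcases Finset.mem_insert.mp (Finset.mem_coe.mp hy) with rfl | h
      · exact hmU
      · exact hAU h
    · rw [Finset.card_insert_of_notMem hmA, hA]
    · intro a ha u hu hua
      rw [Finset.mem_insert]
      by_cases huA : u ∈ A
      · exact Or.inr huA
      rcases Finset.mem_insert.mp ha with rfl | h
      · exact Or.inl (le_antisymm hua (hmin u ⟨⟨hu, hua.trans hmu⟩, huA⟩))
      · exact absurd (hin a h u hu hua) huA

/-- The nodes are the points of `Λ` nearest to `x` on either side, with `x` itself counted on the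
right. The last two clauses exclude gaps: between `x` and a node, counting nodes is the same as
counting `Λ`. -/
theorem exists_nodes {Λ : Set ℝ} (hΛ : Separated Λ) (hr : ∀ x, (Λ ∩ Ici x).Infinite)
    (hl : ∀ x, (Λ ∩ Iio x).Infinite) (x : ℝ) (nl nr : ℕ) :
    ∃ A : Finset ℝ, ↑A ⊆ Λ ∧ (A.filter (· < x)).card = nl ∧ (A.filter (x ≤ ·)).card = nr ∧
      (∀ a ∈ A, x ≤ a → ∀ u ∈ Λ, x ≤ u → u ≤ a → u ∈ A) ∧
      (∀ a ∈ A, a < x → ∀ u ∈ Λ, a ≤ u → u < x → u ∈ A) := by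
  obtain ⟨R, hRU, hR, hRi⟩ := exists_initial_finset (hr x) (fun b =>
    (hΛ.finite_inter_Icc x b).subset fun y hy => ⟨hy.1.1, hy.1.2, hy.2⟩) nr
  have hinf : (Neg.neg ⁻¹' (Λ ∩ Iio x)).Infinite := fun h =>
    hl x ((h.image Neg.neg).subset fun y hy =>
      ⟨-y, by rwa [mem_preimage, neg_neg], neg_neg y⟩)
  obtain ⟨L, hLU, hL, hLi⟩ := exists_initial_finset hinf (fun b =>
    (hΛ.neg.finite_inter_Icc (-x) b).subset fun y hy =>
      ⟨hy.1.1, by have : -y < x := hy.1.2; linarith, hy.2⟩) nl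
  have hRm : ∀ y ∈ R, y ∈ Λ ∧ x ≤ y := fun y hy => hRU hy
  have hLm : ∀ y ∈ L.image Neg.neg, y ∈ Λ ∧ y < x := by
    intro y hy
    obtain ⟨z, hz, rfl⟩ := Finset.mem_image.mp hy
    exact hLU hz
  have h1 : (L.image Neg.neg ∪ R).filter (· < x) = L.image Neg.neg := by
    ext y
    simp only [Finset.mem_filter, Finset.mem_union]
    constructor
    · rintro ⟨h | h, hy⟩
      · exact h
      · exact absurd hy (not_lt.mpr (hRm y h).2)
    · exact fun h => ⟨Or.inl h, (hLm y h).2⟩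
  have h2 : (L.image Neg.neg ∪ R).filter (x ≤ ·) = R := by
    ext y
    simp only [Finset.mem_filter, Finset.mem_union]
    constructor
    · rintro ⟨h | h, hy⟩
      · exact absurd hy (not_le.mpr (hLm y h).2)
      · exact h
    · exact fun h => ⟨Or.inr h, (hRm y h).2⟩
  refine ⟨L.image Neg.neg ∪ R, ?_, ?_, ?_, ?_, ?_⟩
  · intro y hy
    rcases Finset.mem_union.mp (Finset.mem_coe.mp hy) with h | h
    · exact (hLm y h).1
    · exact (hRm y h).1
  · rw [h1, Finset.card_image_of_injective _ neg_injective, hL]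
  · rw [h2, hR]
  · intro a ha hxa u hu hxu hua
    have : a ∈ R := h2 ▸ Finset.mem_filter.mpr ⟨ha, hxa⟩
    exact Finset.mem_union_right _ (hRi a this u ⟨hu, hxu⟩ hua)
  · intro a ha hxa u hu hau hux
    have : a ∈ L.image Neg.neg := h1 ▸ Finset.mem_filter.mpr ⟨ha, hxa⟩
    obtain ⟨z, hz, rfl⟩ := Finset.mem_image.mp this
    refine Finset.mem_union_left _ (Finset.mem_image.mpr ⟨-u, ?_, neg_neg u⟩)
    exact hLi z hz (-u) (show - -u ∈ Λ ∩ Iio x by rw [neg_neg]; exact ⟨hu, hux⟩)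
      (by linarith)

/-! ### From a surplus of points to a quadratic gain -/

theorem intervalIntegral_indicator_Ici {D y : ℝ} (hD : 0 ≤ D) (hy : 0 ≤ y) :
    IntervalIntegrable (fun t => (Ici y).indicator (fun _ => (1 : ℝ)) t) volume 0 D ∧
      ∫ t in (0 : ℝ)..D, (Ici y).indicator (fun _ => (1 : ℝ)) t = max (D - y) 0 := by
  have hint : IntervalIntegrable (fun t => (Ici y).indicator (fun _ => (1 : ℝ)) t) volume 0 D := by
    rw [intervalIntegrable_iff_integrableOn_Ioc_of_le hD]
    exact (integrable_const 1).indicator measurableSet_Ici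
  refine ⟨hint, ?_⟩
  rw [intervalIntegral.integral_of_le hD, ← integral_Icc_eq_integral_Ioc,
    setIntegral_indicator measurableSet_Ici]
  have : Icc 0 D ∩ Ici y = Icc y D := by
    ext t; simp only [mem_inter_iff, mem_Icc, mem_Ici]; constructor
    · rintro ⟨⟨_, h⟩, h'⟩; exact ⟨h', h⟩
    · rintro ⟨h, h'⟩; exact ⟨⟨hy.trans h, h'⟩, h⟩
  rw [this]
  simp [Real.volume_real_Icc]

/-- Each summand is the length of the part of `[0, D]` on which its point is already counted. -/
theorem sum_max_sub_eq_integral (X : Finset ℝ) (φ : ℝ → ℝ) (hφ : ∀ a ∈ X, 0 ≤ φ a) {D : ℝ}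
    (hD : 0 ≤ D) :
    IntervalIntegrable (fun t => ((X.filter (φ · ≤ t)).card : ℝ)) volume 0 D ∧
    ∫ t in (0 : ℝ)..D, ((X.filter (φ · ≤ t)).card : ℝ) = ∑ a ∈ X, max (D - φ a) 0 := by
  have h : (fun t => ((X.filter (φ · ≤ t)).card : ℝ))
      = fun t => ∑ a ∈ X, (Ici (φ a)).indicator (fun _ => (1 : ℝ)) t := by
    funext t
    rw [Finset.card_filter]
    push_cast
    refine Finset.sum_congr rfl fun a _ => ?_
    simp [indicator]
  rw [h]
  constructor
  · have := IntervalIntegrable.sum X (μ := volume) (a := 0) (b := D)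
      (f := fun a t => (Ici (φ a)).indicator (fun _ => (1 : ℝ)) t)
      (fun a ha => (intervalIntegral_indicator_Ici hD (hφ a ha)).1)
    rwa [show (fun t => ∑ a ∈ X, (Ici (φ a)).indicator (fun _ => (1 : ℝ)) t)
      = ∑ a ∈ X, fun t => (Ici (φ a)).indicator (fun _ => (1 : ℝ)) t from
        funext fun t => (Finset.sum_apply ..).symm]
  · rw [intervalIntegral.integral_finsetSum
      (fun a ha => (intervalIntegral_indicator_Ici hD (hφ a ha)).1)]
    exact Finset.sum_congr rfl fun a ha => (intervalIntegral_indicator_Ici hD (hφ a ha)).2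

/-- Integrating the comparison of counts over `[0, D]` turns the linear surplus `c * t` into `c / 2
* D ^ 2`. -/
theorem mul_sum_max_sub_add_le {X Y : Finset ℝ} {φ : ℝ → ℝ} (hX : ∀ a ∈ X, 0 ≤ φ a)
    (hY : ∀ a ∈ Y, 0 ≤ φ a) {D r c C : ℝ} (hD : 0 ≤ D)
    (h : ∀ t ∈ Icc 0 D,
      r * (Y.filter (φ · ≤ t)).card + c * t - C ≤ (X.filter (φ · ≤ t)).card) :
    r * ∑ a ∈ Y, max (D - φ a) 0 + (c / 2 * D ^ 2 - C * D) ≤ ∑ a ∈ X, max (D - φ a) 0 := by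
  obtain ⟨hX1, hX2⟩ := sum_max_sub_eq_integral X φ hX hD
  obtain ⟨hY1, hY2⟩ := sum_max_sub_eq_integral Y φ hY hD
  have hlin : IntervalIntegrable (fun t : ℝ => c * t - C) volume 0 D :=
    (by fun_prop : Continuous fun t : ℝ => c * t - C).intervalIntegrable _ _
  have hlin2 : ∫ t in (0 : ℝ)..D, (c * t - C) = c / 2 * D ^ 2 - C * D := by
    rw [intervalIntegral.integral_sub ((by fun_prop : Continuous fun t : ℝ => c * t).intervalIntegrable _ _)
      (by simp), intervalIntegral.integral_const_mul, integral_id]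
    simp; ring
  rw [← hX2, ← hY2, ← hlin2, ← intervalIntegral.integral_const_mul,
    ← intervalIntegral.integral_add (hY1.const_mul r) hlin]
  refine intervalIntegral.integral_mono_on hD ((hY1.const_mul r).add hlin) hX1 fun t ht => ?_
  have := h t ht
  linarith

/-- Multiplied by `κ`, the left side is the main part of the logarithm of the Lagrange weight at the
node `l`. The points left of `x` give terms linear in `x - l`, which cancel because `A` has exactly
`r` times as many of them as `S`. What is left on the side of `l` is a difference of sums as in
`mul_sum_max_sub_add_le`. -/
theorem sum_max_sub_max_le {A S : Finset ℝ} {x l c C : ℝ} {r : ℕ}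
    (hleft : (A.filter (· < x)).card = r * (S.filter (· < x)).card)
    (hR : x ≤ l → ∀ t ∈ Icc 0 (l - x),
      r * (((S.filter (x ≤ ·)).filter (· - x ≤ t)).card : ℝ) + c * t - C
        ≤ ((A.filter (x ≤ ·)).filter (· - x ≤ t)).card)
    (hL : l < x → ∀ t ∈ Icc 0 (x - l),
      r * (((S.filter (· < x)).filter (x - · ≤ t)).card : ℝ) + c * t - C
        ≤ ((A.filter (· < x)).filter (x - · ≤ t)).card) :
    ∑ a ∈ A, (max x a - max l a) - r * ∑ a ∈ S, (max x a - max l a)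
      ≤ C * |x - l| - c / 2 * |x - l| ^ 2 := by
  have hcard : ((A.filter (· < x)).card : ℝ) = r * (S.filter (· < x)).card := by
    exact_mod_cast hleft
  rcases le_or_gt x l with hxl | hlx
  · have key : ∀ F : Finset ℝ, ∑ a ∈ F, (max x a - max l a) =
        -((l - x) * (F.filter (· < x)).card)
          - ∑ a ∈ F.filter (x ≤ ·), max ((l - x) - (a - x)) 0 := by
      intro F
      rw [← Finset.sum_filter_add_sum_filter_not F (· < x)]
      have e1 : ∑ a ∈ F.filter (· < x), (max x a - max l a)
          = ∑ a ∈ F.filter (· < x), (-(l - x)) := by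
        refine Finset.sum_congr rfl fun a ha => ?_
        have := (Finset.mem_filter.mp ha).2
        rw [max_eq_left this.le, max_eq_left (this.le.trans hxl)]; ring
      have e2 : ∑ a ∈ F.filter (fun a => ¬ a < x), (max x a - max l a)
          = - ∑ a ∈ F.filter (x ≤ ·), max ((l - x) - (a - x)) 0 := by
        rw [← Finset.sum_neg_distrib]
        simp only [not_lt]
        refine Finset.sum_congr rfl fun a ha => ?_
        have := (Finset.mem_filter.mp ha).2
        rw [max_eq_right this]
        rcases le_total l a with h | h
        · rw [max_eq_right h, max_eq_right (by linarith)]; ring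
        · rw [max_eq_left h, max_eq_left (by linarith)]; ring
      rw [e1, e2, Finset.sum_const, nsmul_eq_mul]
      ring
    have := mul_sum_max_sub_add_le (X := A.filter (x ≤ ·)) (Y := S.filter (x ≤ ·))
      (φ := fun a => a - x) (r := r) (c := c) (C := C) (D := l - x)
      (fun a ha => sub_nonneg.mpr (Finset.mem_filter.mp ha).2)
      (fun a ha => sub_nonneg.mpr (Finset.mem_filter.mp ha).2) (by linarith) (hR hxl)
    rw [key A, key S, hcard, abs_sub_comm, abs_of_nonneg (by linarith : 0 ≤ l - x)]
    linarith
  · have key : ∀ F : Finset ℝ, ∑ a ∈ F, (max x a - max l a) =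
        (x - l) * (F.filter (· < x)).card
          - ∑ a ∈ F.filter (· < x), max ((x - l) - (x - a)) 0 := by
      intro F
      rw [← Finset.sum_filter_add_sum_filter_not F (· < x)]
      have e1 : ∑ a ∈ F.filter (· < x), (max x a - max l a)
          = ∑ a ∈ F.filter (· < x), ((x - l) - max ((x - l) - (x - a)) 0) := by
        refine Finset.sum_congr rfl fun a ha => ?_
        have := (Finset.mem_filter.mp ha).2
        rw [max_eq_left this.le]
        rcases le_total l a with h | h
        · rw [max_eq_right h, max_eq_left (by linarith)]; ring
        · rw [max_eq_left h, max_eq_right (by linarith)]; ring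
      have e2 : ∑ a ∈ F.filter (fun a => ¬ a < x), (max x a - max l a) = 0 := by
        refine Finset.sum_eq_zero fun a ha => ?_
        have := not_lt.mp (Finset.mem_filter.mp ha).2
        rw [max_eq_right this, max_eq_right (hlx.le.trans this)]; ring
      rw [e1, e2, Finset.sum_sub_distrib, Finset.sum_const, nsmul_eq_mul]
      ring
    have := mul_sum_max_sub_add_le (X := A.filter (· < x)) (Y := S.filter (· < x))
      (φ := fun a => x - a) (r := r) (c := c) (C := C) (D := x - l)
      (fun a ha => sub_nonneg.mpr (Finset.mem_filter.mp ha).2.le)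
      (fun a ha => sub_nonneg.mpr (Finset.mem_filter.mp ha).2.le) (by linarith) (hL hlx)
    rw [key A, key S, hcard, abs_of_nonneg (by linarith : 0 ≤ x - l)]
    linarith

/-! ### Growth of polynomials in exponentials, with summable errors -/

open Polynomial in
theorem eval_eq_pow_mul_eval_reverse (Q : ℂ[X]) {x : ℂ} (hx : x ≠ 0) :
    Q.eval x = x ^ Q.natDegree * Q.reverse.eval x⁻¹ := by
  let _ := invertibleOfNonzero hx
  have := eval₂_reverse_mul_pow (RingHom.id ℂ) x Q
  rw [invOf_eq_inv] at this
  rw [eval, eval, ← this, mul_comm]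

open Polynomial in
theorem eval_reverse_ne_zero {Q : ℂ[X]} (hQ : ∀ x : ℝ, 0 ≤ x → Q.eval (x : ℂ) ≠ 0) (x : ℝ)
    (hx : 0 ≤ x) : Q.reverse.eval (x : ℂ) ≠ 0 := by
  have hQ0 : Q ≠ 0 := by rintro rfl; exact hQ 0 le_rfl (by simp)
  rcases hx.eq_or_lt with rfl | hx
  · rw [Complex.ofReal_zero, ← coeff_zero_eq_eval_zero, coeff_zero_reverse]
    exact leadingCoeff_ne_zero.mpr hQ0
  · intro h
    refine hQ x⁻¹ (inv_nonneg.mpr hx.le) ?_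
    rw [eval_eq_pow_mul_eval_reverse Q (by exact_mod_cast (inv_pos.mpr hx).ne'),
      Complex.ofReal_inv, inv_inv, h, mul_zero]

open Polynomial in
theorem exists_norm_eval_le (R : ℂ[X]) :
    ∃ M : ℝ, 0 < M ∧ ∀ x ∈ Icc (0 : ℝ) 1, ‖R.eval (x : ℂ)‖ ≤ M := by
  obtain ⟨M, hM⟩ := isCompact_Icc.exists_bound_of_continuousOn (s := Icc (0 : ℝ) 1)
    (f := fun x : ℝ => R.eval (x : ℂ)) (by fun_prop)
  exact ⟨max M 1, by positivity, fun x hx => (hM x hx).trans (le_max_left _ _)⟩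

open Polynomial in
theorem exists_le_norm_eval {R : ℂ[X]} (hR : ∀ x : ℝ, 0 ≤ x → R.eval (x : ℂ) ≠ 0) :
    ∃ c : ℝ, 0 < c ∧ ∀ x ∈ Icc (0 : ℝ) 1, c ≤ ‖R.eval (x : ℂ)‖ := by
  obtain ⟨m, hm, hmin⟩ := (isCompact_Icc (a := (0 : ℝ)) (b := 1)).exists_isMinOn ⟨0, by simp⟩
    (f := fun x : ℝ => ‖R.eval (x : ℂ)‖) (by fun_prop)
  exact ⟨_, norm_pos_iff.mpr (hR m hm.1), fun x hx => hmin hx⟩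

-- Both values differ from `R(0)` by `O(x)` and `O(y)`, and `R` is bounded away from zero, so `1 + u
-- ≤ e^u` applies. The error vanishes with `x` and `y`, which later keeps products over many shifts
-- bounded.
open Polynomial in
theorem exists_norm_eval_le_mul_exp {R : ℂ[X]} (hR : ∀ x : ℝ, 0 ≤ x → R.eval (x : ℂ) ≠ 0) :
    ∃ C : ℝ, 0 < C ∧ ∀ x ∈ Icc (0 : ℝ) 1, ∀ y ∈ Icc (0 : ℝ) 1,
      ‖R.eval (x : ℂ)‖ ≤ ‖R.eval (y : ℂ)‖ * Real.exp (C * (x + y)) := by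
  obtain ⟨c, hc, hcR⟩ := exists_le_norm_eval hR
  obtain ⟨M, hM, hMR⟩ := exists_norm_eval_le R.divX
  refine ⟨M / c, by positivity, fun x hx y hy => ?_⟩
  have hx' : ∀ z : ℂ, R.eval z = R.divX.eval z * z + R.coeff 0 := fun z => by
    conv_lhs => rw [← divX_mul_X_add R]
    simp
  have h1 : ‖R.eval (x : ℂ)‖ ≤ ‖R.eval (y : ℂ)‖ + M * (x + y) := by
    have h2 : R.eval (x : ℂ) = R.eval (y : ℂ) + (R.divX.eval (x : ℂ) * x - R.divX.eval (y : ℂ) * y) := by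
      rw [hx' x, hx' y]; ring
    have h3 : ∀ z ∈ Icc (0 : ℝ) 1, ‖R.divX.eval (z : ℂ) * z‖ ≤ M * z := fun z hz => by
      rw [norm_mul, Complex.norm_real, Real.norm_of_nonneg hz.1]
      exact mul_le_mul_of_nonneg_right (hMR z hz) hz.1
    rw [h2]
    have := norm_add_le (R.eval (y : ℂ)) (R.divX.eval (x : ℂ) * x - R.divX.eval (y : ℂ) * y)
    have := norm_sub_le (R.divX.eval (x : ℂ) * x) (R.divX.eval (y : ℂ) * y)
    linarith [h3 x hx, h3 y hy]
  refine h1.trans ?_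
  have h4 : 0 ≤ M / c * (x + y) := mul_nonneg (by positivity) (add_nonneg hx.1 hy.1)
  calc ‖R.eval (y : ℂ)‖ + M * (x + y)
      = ‖R.eval (y : ℂ)‖ + c * (M / c * (x + y)) := by field_simp
    _ ≤ ‖R.eval (y : ℂ)‖ + ‖R.eval (y : ℂ)‖ * (M / c * (x + y)) := by
        gcongr; exact hcR y hy
    _ = ‖R.eval (y : ℂ)‖ * (M / c * (x + y) + 1) := by ring
    _ ≤ _ := by gcongr; exact Real.add_one_le_exp _

-- Once the growth is pulled out, a polynomial at `e^{-κ|t|} ∈ [0, 1]` remains: the reverse of `Q`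
-- for `t ≥ 0`, and `Q` itself for `t ≤ 0`.
open Polynomial in
theorem norm_eval_exp_of_nonneg (Q : ℂ[X]) {κ t : ℝ} (ht : 0 ≤ t) :
    ‖Q.eval ((Real.exp (κ * t) : ℝ) : ℂ)‖ = Real.exp (Q.natDegree * κ * max t 0) *
      ‖Q.reverse.eval ((Real.exp (-κ * |t|) : ℝ) : ℂ)‖ := by
  rw [eval_eq_pow_mul_eval_reverse Q (by exact_mod_cast (Real.exp_pos _).ne'), norm_mul, norm_pow,
    Complex.norm_real, Real.norm_of_nonneg (Real.exp_pos _).le, ← Real.exp_nat_mul,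
    max_eq_left ht, abs_of_nonneg ht, ← Complex.ofReal_inv, ← Real.exp_neg, ← mul_assoc, neg_mul]

open Polynomial in
theorem norm_eval_exp_of_nonpos (Q : ℂ[X]) {κ t : ℝ} (ht : t ≤ 0) :
    ‖Q.eval ((Real.exp (κ * t) : ℝ) : ℂ)‖ = Real.exp (Q.natDegree * κ * max t 0) *
      ‖Q.eval ((Real.exp (-κ * |t|) : ℝ) : ℂ)‖ := by
  rw [max_eq_right ht, abs_of_nonpos ht]
  simp

theorem exp_neg_mul_abs_mem {κ : ℝ} (hκ : 0 < κ) (t : ℝ) :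
    Real.exp (-κ * |t|) ∈ Icc (0 : ℝ) 1 :=
  ⟨(Real.exp_pos _).le, Real.exp_le_one_iff.mpr (by nlinarith [abs_nonneg t])⟩

-- For `s` and `t` on the same side of `0` the same polynomial on `[0, 1]` is compared with itself,
-- and the error is exponentially small in `|s|` and `|t|`. A bounded loss occurs only when `0`
-- separates them; in the product over the shifts this happens only for centres between the two
-- points.
open Polynomial in
theorem exists_norm_eval_exp_div_le {κ : ℝ} (hκ : 0 < κ) {Q : ℂ[X]}
    (hQ : ∀ x : ℝ, 0 ≤ x → Q.eval (x : ℂ) ≠ 0) :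
    ∃ C : ℝ, 0 < C ∧ ∀ s t : ℝ,
      ‖Q.eval ((Real.exp (κ * s) : ℝ) : ℂ)‖ / ‖Q.eval ((Real.exp (κ * t) : ℝ) : ℂ)‖ ≤
        Real.exp (Q.natDegree * κ * (max s 0 - max t 0) +
          C * (Real.exp (-κ * |s|) + Real.exp (-κ * |t|) + if s * t < 0 then 2 else 0)) := by
  obtain ⟨C₁, hC₁, h₁⟩ := exists_norm_eval_le_mul_exp hQ
  obtain ⟨C₂, hC₂, h₂⟩ := exists_norm_eval_le_mul_exp (R := Q.reverse) (eval_reverse_ne_zero hQ)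
  have hC : 0 < max C₁ C₂ := lt_max_of_lt_left hC₁
  have pos : ∀ t, 0 < ‖Q.eval ((Real.exp (κ * t) : ℝ) : ℂ)‖ := fun t =>
    norm_pos_iff.mpr (hQ _ (Real.exp_pos _).le)
  have key : ∀ s t : ℝ, (0 ≤ s ∧ 0 ≤ t ∨ s ≤ 0 ∧ t ≤ 0) →
      ‖Q.eval ((Real.exp (κ * s) : ℝ) : ℂ)‖ / ‖Q.eval ((Real.exp (κ * t) : ℝ) : ℂ)‖ ≤
        Real.exp (Q.natDegree * κ * (max s 0 - max t 0) +
          max C₁ C₂ * (Real.exp (-κ * |s|) + Real.exp (-κ * |t|))) := by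
    intro s t hst
    rw [div_le_iff₀ (pos t)]
    have hE : 0 ≤ Real.exp (-κ * |s|) + Real.exp (-κ * |t|) := by positivity
    have split : Real.exp (Q.natDegree * κ * (max s 0 - max t 0) +
          max C₁ C₂ * (Real.exp (-κ * |s|) + Real.exp (-κ * |t|))) *
            Real.exp (Q.natDegree * κ * max t 0) = Real.exp (Q.natDegree * κ * max s 0) *
          Real.exp (max C₁ C₂ * (Real.exp (-κ * |s|) + Real.exp (-κ * |t|))) := by
      rw [← Real.exp_add, ← Real.exp_add]; congr 1; ring
    rcases hst with ⟨hs, ht⟩ | ⟨hs, ht⟩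
    · rw [norm_eval_exp_of_nonneg Q hs, norm_eval_exp_of_nonneg Q ht, ← mul_assoc, split]
      refine (mul_le_mul_of_nonneg_left ?_ (Real.exp_pos _).le).trans_eq (mul_assoc _ _ _).symm
      refine (h₂ _ (exp_neg_mul_abs_mem hκ s) _ (exp_neg_mul_abs_mem hκ t)).trans ?_
      rw [mul_comm]
      gcongr
      exact le_max_right _ _
    · rw [norm_eval_exp_of_nonpos Q hs, norm_eval_exp_of_nonpos Q ht, ← mul_assoc, split]
      refine (mul_le_mul_of_nonneg_left ?_ (Real.exp_pos _).le).trans_eq (mul_assoc _ _ _).symm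
      refine (h₁ _ (exp_neg_mul_abs_mem hκ s) _ (exp_neg_mul_abs_mem hκ t)).trans ?_
      rw [mul_comm]
      gcongr
      exact le_max_left _ _
  refine ⟨max C₁ C₂, hC, fun s t => ?_⟩
  split_ifs with hst
  -- For opposite signs the comparison passes through `0`. Each of the two ratios contributes an
  -- error `e^0 = 1`, whence the `2`.
  · have k1 := key s 0 (by rcases le_total s 0 with h | h <;> simp [h])
    have k2 := key 0 t (by rcases le_total t 0 with h | h <;> simp [h])
    have h3 := mul_le_mul k1 k2 (by positivity) (by positivity)
    rw [div_mul_div_cancel₀ (pos 0).ne', ← Real.exp_add] at h3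
    refine h3.trans (Real.exp_le_exp.mpr (le_of_eq ?_))
    simp
    ring
  · rw [add_zero]
    refine key s t ?_
    rcases le_total s 0 with h | h <;> rcases le_total t 0 with h' | h'
    · exact Or.inr ⟨h, h'⟩
    · rcases h.eq_or_lt with rfl | h
      · exact Or.inl ⟨le_rfl, h'⟩
      rcases h'.eq_or_lt with rfl | h'
      · exact Or.inr ⟨h.le, le_rfl⟩
      exact absurd (mul_neg_of_neg_of_pos h h') hst
    · rcases h.eq_or_lt with rfl | h
      · exact Or.inr ⟨le_rfl, h'⟩
      rcases h'.eq_or_lt with rfl | h'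
      · exact Or.inl ⟨h.le, le_rfl⟩
      exact absurd (mul_neg_of_pos_of_neg h h') hst
    · exact Or.inl ⟨h, h'⟩

theorem abs_exp_sub_exp (κ : ℝ) (hκ : 0 < κ) (a b : ℝ) :
    |Real.exp (κ * a) - Real.exp (κ * b)| =
      Real.exp (κ * max a b) * (1 - Real.exp (-κ * |a - b|)) := by
  wlog h : a ≤ b generalizing a b
  · rw [abs_sub_comm, this b a (le_of_not_ge h), max_comm, abs_sub_comm b a]
  have : κ * a ≤ κ * b := by gcongr
  rw [abs_sub_comm, abs_of_nonneg (sub_nonneg.mpr (Real.exp_le_exp.mpr this)), max_eq_right h,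
    abs_of_nonpos (by linarith), mul_sub, mul_one, ← Real.exp_add]
  congr 2
  ring

/-- Without the factors `e^{κ max}`, the numerator is at most `1` and the denominator is `1 - w`
with `w ≤ e^{-κδ}`. Then `1 / (1 - w) = 1 + w / (1 - w)` is at most the exponential of a multiple of
`w`, and such `w` are summable over a separated set. -/
theorem abs_exp_sub_exp_div_le {κ δ x y z : ℝ} (hκ : 0 < κ) (hδ : 0 < δ) (hzy : δ ≤ |z - y|) :
    |Real.exp (κ * x) - Real.exp (κ * y)| / |Real.exp (κ * z) - Real.exp (κ * y)| ≤
      Real.exp (κ * (max x y - max z y) +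
        (1 - Real.exp (-κ * δ))⁻¹ * Real.exp (-κ * |z - y|)) := by
  have h0 : Real.exp (-κ * δ) < 1 := Real.exp_lt_one_iff.mpr (by nlinarith)
  have h1 : Real.exp (-κ * |z - y|) ≤ Real.exp (-κ * δ) := Real.exp_le_exp.mpr (by nlinarith)
  set w := Real.exp (-κ * |z - y|) with hw
  have hw1 : 0 < 1 - w := by linarith
  have hw0 : 0 < w := Real.exp_pos _
  rw [abs_exp_sub_exp κ hκ, abs_exp_sub_exp κ hκ, ← hw, div_le_iff₀ (by positivity)]
  have e : Real.exp (κ * (max x y - max z y) + (1 - Real.exp (-κ * δ))⁻¹ * w) *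
      (Real.exp (κ * max z y) * (1 - w)) = Real.exp (κ * max x y) *
        (Real.exp ((1 - Real.exp (-κ * δ))⁻¹ * w) * (1 - w)) := by
    rw [← mul_assoc, ← mul_assoc, ← Real.exp_add, ← Real.exp_add]; congr 2; ring
  rw [e]
  gcongr
  have h2 : (1 - w)⁻¹ ≤ (1 - Real.exp (-κ * δ))⁻¹ := by
    apply inv_anti₀ <;> linarith
  have h3 : (1 - w)⁻¹ ≤ Real.exp ((1 - Real.exp (-κ * δ))⁻¹ * w) := by
    calc (1 - w)⁻¹ = (1 - w)⁻¹ * w + 1 := by field_simp; ring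
      _ ≤ (1 - Real.exp (-κ * δ))⁻¹ * w + 1 := by gcongr
      _ ≤ _ := Real.add_one_le_exp _
  calc 1 - Real.exp (-κ * |x - y|) ≤ 1 := by linarith [Real.exp_pos (-κ * |x - y|)]
    _ = (1 - w)⁻¹ * (1 - w) := by field_simp
    _ ≤ _ := by gcongr

/-! ### Lagrange interpolation of finite sums of shifts -/

/-- The function `e^{σx} P(e^{κx}) / Q(e^{κx})` on the real line. -/
noncomputable def expRational (κ σ : ℝ) (P Q : Polynomial ℂ) (x : ℝ) : ℂ :=
  (Real.exp (σ * x) : ℝ) * P.eval ((Real.exp (κ * x) : ℝ) : ℂ) /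
    Q.eval ((Real.exp (κ * x) : ℝ) : ℂ)

open Polynomial in
/-- The numerator, as a polynomial in `e^{κx}`, of a finite sum of shifts of `expRational`. -/
noncomputable def shiftNumerator (κ σ : ℝ) (P Q : ℂ[X]) (S : Finset ℝ) (d : ℝ → ℂ) : ℂ[X] :=
  ∑ γ ∈ S, C (d γ * (Real.exp (-σ * γ) : ℝ)) *
    (P.comp (C ((Real.exp (-κ * γ) : ℝ) : ℂ) * X) *
      ∏ η ∈ S.erase γ, Q.comp (C ((Real.exp (-κ * η) : ℝ) : ℂ) * X))

open Polynomial in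
theorem eval_comp_exp (P : ℂ[X]) (κ x γ : ℝ) :
    (P.comp (C ((Real.exp (-κ * γ) : ℝ) : ℂ) * X)).eval ((Real.exp (κ * x) : ℝ) : ℂ) =
      P.eval ((Real.exp (κ * (x - γ)) : ℝ) : ℂ) := by
  rw [eval_comp, eval_mul, eval_C, eval_X, ← Complex.ofReal_mul, ← Real.exp_add]
  congr 3
  ring_nf

-- In `e^{σ(x - γ)} = e^{σx} e^{-σγ}` the first factor is common to all terms and is divided out,
-- the second goes into the coefficient. Clearing denominators leaves a polynomial in `e^{κx}`.
open Polynomial in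
theorem eval_shiftNumerator {κ σ : ℝ} {P Q : ℂ[X]} (hQ : ∀ x : ℝ, 0 ≤ x → Q.eval (x : ℂ) ≠ 0)
    (S : Finset ℝ) (d : ℝ → ℂ) (x : ℝ) :
    (shiftNumerator κ σ P Q S d).eval ((Real.exp (κ * x) : ℝ) : ℂ) =
      (Real.exp (-σ * x) : ℝ) * (∑ γ ∈ S, d γ * expRational κ σ P Q (x - γ)) *
        ∏ γ ∈ S, Q.eval ((Real.exp (κ * (x - γ)) : ℝ) : ℂ) := by
  rw [shiftNumerator, eval_finsetSum, Finset.mul_sum, Finset.sum_mul]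
  refine Finset.sum_congr rfl fun γ hγ => ?_
  rw [eval_mul, eval_mul, eval_C, eval_prod, eval_comp_exp, ← Finset.mul_prod_erase S _ hγ]
  simp_rw [eval_comp_exp]
  have h0 := hQ _ (Real.exp_pos (κ * (x - γ))).le
  have h1 : ((Real.exp (-σ * γ) : ℝ) : ℂ) =
      (Real.exp (-σ * x) : ℝ) * (Real.exp (σ * (x - γ)) : ℝ) := by
    rw [← Complex.ofReal_mul, ← Real.exp_add]; congr 2; ring
  rw [expRational, h1]
  generalize Q.eval ((Real.exp (κ * (x - γ)) : ℝ) : ℂ) = q at h0 ⊢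
  field_simp

-- In every summand one factor `Q` is replaced by `P`, of smaller degree. Working with `degree`
-- covers `S = ∅`, where the numerator is zero.
open Polynomial in
theorem degree_shiftNumerator_lt {κ σ : ℝ} {P Q : ℂ[X]} (hPQ : P.natDegree < Q.natDegree)
    (S : Finset ℝ) (d : ℝ → ℂ) :
    (shiftNumerator κ σ P Q S d).degree < (Q.natDegree * S.card : ℕ) := by
  refine (degree_sum_le _ _).trans_lt ?_
  rw [Finset.sup_lt_iff (WithBot.bot_lt_coe _)]
  intro γ hγ
  refine degree_le_natDegree.trans_lt ?_
  rw [Nat.cast_lt]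
  have hlin : ∀ c : ℂ, (C c * X).natDegree ≤ 1 := fun c => (natDegree_C_mul_le c X).trans natDegree_X_le
  have hcomp : ∀ (R : ℂ[X]) (c : ℂ), (R.comp (C c * X)).natDegree ≤ R.natDegree := fun R c =>
    natDegree_comp_le.trans ((Nat.mul_le_mul_left _ (hlin c)).trans (mul_one _).le)
  calc _ ≤ (P.comp (C ((Real.exp (-κ * γ) : ℝ) : ℂ) * X) *
        ∏ η ∈ S.erase γ, Q.comp (C ((Real.exp (-κ * η) : ℝ) : ℂ) * X)).natDegree :=
        natDegree_C_mul_le _ _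
    _ ≤ P.natDegree + ∑ η ∈ S.erase γ, Q.natDegree :=
        natDegree_mul_le.trans (add_le_add (hcomp _ _)
          ((natDegree_prod_le _ _).trans (Finset.sum_le_sum fun η _ => hcomp _ _)))
    _ < Q.natDegree + ∑ η ∈ S.erase γ, Q.natDegree := by gcongr
    _ = Q.natDegree * S.card := by
        rw [Finset.add_sum_erase S (fun _ => Q.natDegree) hγ, Finset.sum_const, smul_eq_mul,
          mul_comm]

open Polynomial in
theorem norm_sum_shifts_le_lagrange {κ : ℝ} (hκ : 0 < κ) (σ : ℝ) {P Q : ℂ[X]}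
    (hPQ : P.natDegree < Q.natDegree) (hQ : ∀ x : ℝ, 0 ≤ x → Q.eval (x : ℂ) ≠ 0)
    {S A : Finset ℝ} (hA : A.card = Q.natDegree * S.card) (d : ℝ → ℂ) (x : ℝ) :
    ‖∑ γ ∈ S, d γ * expRational κ σ P Q (x - γ)‖ ≤
      ∑ a ∈ A, ‖∑ γ ∈ S, d γ * expRational κ σ P Q (a - γ)‖ * (Real.exp (σ * (x - a)) *
        (∏ γ ∈ S, ‖Q.eval ((Real.exp (κ * (a - γ)) : ℝ) : ℂ)‖ /
          ‖Q.eval ((Real.exp (κ * (x - γ)) : ℝ) : ℂ)‖) *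
        ∏ b ∈ A.erase a, |Real.exp (κ * x) - Real.exp (κ * b)| /
          |Real.exp (κ * a) - Real.exp (κ * b)|) := by
  set f : ℝ → ℂ := fun y => ∑ γ ∈ S, d γ * expRational κ σ P Q (y - γ) with hf
  set N := shiftNumerator κ σ P Q S d with hN
  set D : ℝ → ℂ := fun y => ∏ γ ∈ S, Q.eval ((Real.exp (κ * (y - γ)) : ℝ) : ℂ) with hD
  have hNe : ∀ y : ℝ, N.eval ((Real.exp (κ * y) : ℝ) : ℂ) =
      (Real.exp (-σ * y) : ℝ) * f y * D y := fun y => eval_shiftNumerator hQ S d y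
  have hinj : InjOn (fun a : ℝ => ((Real.exp (κ * a) : ℝ) : ℂ)) (A : Set ℝ) := by
    intro a _ b _ h
    exact mul_left_cancel₀ hκ.ne' (Real.exp_injective (Complex.ofReal_injective h))
  have hint := Lagrange.eq_interpolate (f := N) hinj
    (by rw [hA]; exact degree_shiftNumerator_lt hPQ S d)
  have h1 := congrArg (eval ((Real.exp (κ * x) : ℝ) : ℂ)) hint
  rw [Lagrange.interpolate_apply, eval_finsetSum, hNe] at h1
  have hDx : 0 < ‖D x‖ := by
    rw [hD, norm_pos_iff]
    exact Finset.prod_ne_zero_iff.mpr fun γ _ => hQ _ (Real.exp_pos _).le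
  have h2 : Real.exp (-σ * x) * ‖f x‖ * ‖D x‖ ≤ ∑ a ∈ A, Real.exp (-σ * a) * ‖f a‖ * ‖D a‖ *
      ∏ b ∈ A.erase a, |Real.exp (κ * x) - Real.exp (κ * b)| /
          |Real.exp (κ * a) - Real.exp (κ * b)| := by
    have h3 := congrArg norm h1
    rw [norm_mul, norm_mul, Complex.norm_real, Real.norm_of_nonneg (Real.exp_pos _).le] at h3
    rw [h3]
    refine (norm_sum_le _ _).trans (Finset.sum_le_sum fun a _ => le_of_eq ?_)
    rw [eval_mul, eval_C, hNe, norm_mul, norm_mul, norm_mul, Complex.norm_real,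
      Real.norm_of_nonneg (Real.exp_pos _).le]
    congr 1
    rw [Lagrange.basis, eval_prod, norm_prod]
    refine Finset.prod_congr rfl fun b _ => ?_
    rw [Lagrange.basisDivisor, eval_mul, eval_C, eval_sub, eval_X, eval_C, norm_mul, norm_inv,
      ← Complex.ofReal_sub, ← Complex.ofReal_sub, Complex.norm_real, Complex.norm_real,
      Real.norm_eq_abs, Real.norm_eq_abs, mul_comm, div_eq_mul_inv]
  have h4 : ‖f x‖ = (Real.exp (σ * x) / ‖D x‖) * (Real.exp (-σ * x) * ‖f x‖ * ‖D x‖) := by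
    rw [neg_mul, Real.exp_neg]; field_simp
  rw [h4]
  refine (mul_le_mul_of_nonneg_left h2 (by positivity)).trans (le_of_eq ?_)
  rw [Finset.mul_sum]
  refine Finset.sum_congr rfl fun a _ => ?_
  have h5 : Real.exp (σ * (x - a)) = Real.exp (σ * x) * Real.exp (-σ * a) := by
    rw [← Real.exp_add]; congr 1; ring
  have h6 : ∏ γ ∈ S, ‖Q.eval ((Real.exp (κ * (a - γ)) : ℝ) : ℂ)‖ /
      ‖Q.eval ((Real.exp (κ * (x - γ)) : ℝ) : ℂ)‖ = ‖D a‖ / ‖D x‖ := by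
    rw [Finset.prod_div_distrib, ← norm_prod, ← norm_prod]
  rw [h5, h6]
  simp only [hf]
  ring

/-! ### Gaussian decay of the Lagrange weights -/

theorem exists_exp_quadratic_le {a : ℝ} (ha : 0 < a) (b c : ℝ) :
    ∃ C : ℝ, 0 < C ∧ ∀ t : ℝ, Real.exp (b * t + c - a * t ^ 2) ≤ C * Real.exp (-t) := by
  -- The exponent is the maximum over `t` of `(b + 1) * t + c - a * t ^ 2`.
  refine ⟨Real.exp ((b + 1) ^ 2 / (4 * a) + c), Real.exp_pos _, fun t => ?_⟩
  rw [← Real.exp_add]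
  apply Real.exp_le_exp.mpr
  have : (b + 1) ^ 2 / (4 * a) - (b + 1) * t + a * t ^ 2 = a * (t - (b + 1) / (2 * a)) ^ 2 := by
    field_simp; ring
  have := mul_nonneg ha.le (sq_nonneg (t - (b + 1) / (2 * a)))
  linarith

/-- `Λ` has more points than `r` times those of `Γ` in every long interval. -/
def Denser (r : ℕ) (Γ Λ : Set ℝ) : Prop :=
  ∃ c C : ℝ, 0 < c ∧ ∀ a b : ℝ, a ≤ b →
    r * ((Γ ∩ Icc a b).ncard : ℝ) + c * (b - a) - C ≤ ((Λ ∩ Icc a b).ncard : ℝ)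

theorem Denser.infinite_Ici {r : ℕ} {Γ Λ : Set ℝ} (h : Denser r Γ Λ) (x : ℝ) :
    (Λ ∩ Ici x).Infinite := by
  obtain ⟨c, C, hc, h⟩ := h
  intro hfin
  set n := ((Λ ∩ Ici x).ncard : ℝ)
  have h1 : 0 ≤ (|C| + n + 1) / c := by positivity
  have h2 := h x (x + (|C| + n + 1) / c) (by linarith)
  have h3 : ((Λ ∩ Icc x (x + (|C| + n + 1) / c)).ncard : ℝ) ≤ n := by
    exact Nat.cast_le.mpr (ncard_le_ncard (inter_subset_inter_right _ Icc_subset_Ici_self) hfin)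
  have h4 : c * (x + (|C| + n + 1) / c - x) = |C| + n + 1 := by field_simp; ring
  have h5 : 0 ≤ r * ((Γ ∩ Icc x (x + (|C| + n + 1) / c)).ncard : ℝ) := by positivity
  linarith [le_abs_self C]

theorem Denser.infinite_Iio {r : ℕ} {Γ Λ : Set ℝ} (h : Denser r Γ Λ) (x : ℝ) :
    (Λ ∩ Iio x).Infinite := by
  obtain ⟨c, C, hc, h⟩ := h
  intro hfin
  set n := ((Λ ∩ Iio x).ncard : ℝ)
  have h1 : 0 ≤ (|C| + n + 1) / c := by positivity
  have h2 := h (x - 1 - (|C| + n + 1) / c) (x - 1) (by linarith)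
  have h3 : ((Λ ∩ Icc (x - 1 - (|C| + n + 1) / c) (x - 1)).ncard : ℝ) ≤ n := by
    exact Nat.cast_le.mpr (ncard_le_ncard (inter_subset_inter_right _
      fun y hy => lt_of_le_of_lt hy.2 (by linarith)) hfin)
  have h4 : c * (x - 1 - (x - 1 - (|C| + n + 1) / c)) = |C| + n + 1 := by field_simp; ring
  have h5 : 0 ≤ r * ((Γ ∩ Icc (x - 1 - (|C| + n + 1) / c) (x - 1)).ncard : ℝ) := by positivity
  linarith [le_abs_self C]

theorem ncard_preimage_neg_inter_Icc (Γ : Set ℝ) (a b : ℝ) :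
    ((Neg.neg ⁻¹' Γ) ∩ Icc a b).ncard = (Γ ∩ Icc (-b) (-a)).ncard := by
  rw [← ncard_image_of_injective _ (neg_injective (G := ℝ))]
  congr 1
  ext y
  constructor
  · rintro ⟨z, ⟨hz, h1, h2⟩, rfl⟩
    exact ⟨hz, by constructor <;> linarith⟩
  · rintro ⟨hy, h1, h2⟩
    exact ⟨-y, ⟨by rwa [mem_preimage, neg_neg], by constructor <;> linarith⟩, neg_neg y⟩

theorem Denser.neg {r : ℕ} {Γ Λ : Set ℝ} (h : Denser r Γ Λ) :
    Denser r (Neg.neg ⁻¹' Γ) (Neg.neg ⁻¹' Λ) := by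
  obtain ⟨c, C, hc, h⟩ := h
  refine ⟨c, C, hc, fun a b hab => ?_⟩
  rw [ncard_preimage_neg_inter_Icc, ncard_preimage_neg_inter_Icc]
  have := h (-b) (-a) (by linarith)
  linarith

-- The nodes contribute `κ ∑ (max x b - max a b)` to the exponent of the weight at `a`, and the
-- denominators contribute `-κ r` times the same sum over `S`. By `sum_max_sub_max_le` the total is
-- at most a negative quadratic plus linear terms in `|x - a|`. The Gaussian absorbs all linear
-- errors, including `e^{σ(x - a)}`, with constants depending on neither `S` nor `x`.
open Polynomial in
theorem exists_norm_sum_shifts_le {κ : ℝ} (hκ : 0 < κ) (σ : ℝ) {P Q : ℂ[X]}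
    (hPQ : P.natDegree < Q.natDegree) (hQ : ∀ x : ℝ, 0 ≤ x → Q.eval (x : ℂ) ≠ 0)
    {Γ Λ : Set ℝ} (hΓ : Separated Γ) (hΛ : Separated Λ) (hden : Denser Q.natDegree Γ Λ) :
    ∃ C : ℝ, 0 < C ∧ ∀ (S : Finset ℝ) (d : ℝ → ℂ) (x : ℝ), ↑S ⊆ Γ →
      ∃ A : Finset ℝ, ↑A ⊆ Λ ∧ ‖∑ γ ∈ S, d γ * expRational κ σ P Q (x - γ)‖ ≤
        C * ∑ a ∈ A, Real.exp (-|x - a|) * ‖∑ γ ∈ S, d γ * expRational κ σ P Q (a - γ)‖ := by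
  obtain ⟨c, C₀, hc, hcount⟩ := id hden
  obtain ⟨CQ, hCQ, hratio⟩ := exists_norm_eval_exp_div_le hκ hQ
  obtain ⟨EΓ, hEΓ, hexpΓ⟩ := hΓ.exists_sum_exp_le hκ
  obtain ⟨EΛ, hEΛ, hexpΛ⟩ := hΛ.exists_sum_exp_le hκ
  obtain ⟨B, hB, hcard⟩ := hΓ.exists_card_le
  obtain ⟨δ, hδ, hsep⟩ := id hΛ
  set K := (1 - Real.exp (-κ * δ))⁻¹ with hK
  have hK0 : 0 < K := by
    rw [hK, inv_pos, sub_pos]; exact Real.exp_lt_one_iff.mpr (by nlinarith)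
  -- Linear terms: `|σ|` from the factor `e^{σ(x - a)}`, `κ * (C₀ + 1)` from the counting, `2 * CQ *
  -- B` from the centres between `x` and `a`. The constant terms are the exponential sums over `Γ`
  -- and `Λ` and the additive part of the count of those centres.
  obtain ⟨C, hC, hquad⟩ := exists_exp_quadratic_le (a := κ * (c / 2)) (by positivity)
    (|σ| + κ * (C₀ + 1) + 2 * CQ * B) (2 * CQ * EΓ + 2 * CQ * B + K * EΛ)
  refine ⟨C, hC, fun S d x hS => ?_⟩
  obtain ⟨A, hAΛ, hAl, hAr, hAR, hAL⟩ := exists_nodes hΛ hden.infinite_Ici hden.infinite_Iio x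
    (Q.natDegree * (S.filter (· < x)).card) (Q.natDegree * (S.filter (x ≤ ·)).card)
  have hAcard : A.card = Q.natDegree * S.card := by
    rw [← Finset.card_filter_add_card_filter_not (s := A) (· < x),
      ← Finset.card_filter_add_card_filter_not (s := S) (· < x)]
    simp only [not_lt]
    rw [hAl, hAr, mul_add]
  refine ⟨A, hAΛ, (norm_sum_shifts_le_lagrange hκ σ hPQ hQ hAcard d x).trans ?_⟩
  rw [Finset.mul_sum]
  refine Finset.sum_le_sum fun a ha => ?_
  refine (mul_comm _ _).trans_le
    ((mul_le_mul_of_nonneg_right ?_ (norm_nonneg _)).trans_eq (mul_assoc _ _ _))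
  have hexpo := sum_max_sub_max_le (A := A) (S := S) (x := x) (l := a) (c := c) (C := C₀ + 1)
    (r := Q.natDegree) hAl
    (by
      intro hxa t ht
      have h1 := hcount x (x + t) (by linarith [ht.1])
      have h2 : (((S.filter (x ≤ ·)).filter (· - x ≤ t)).card : ℝ) ≤
          ((Γ ∩ Icc x (x + t)).ncard : ℝ) := by
        rw [← ncard_coe_finset]
        refine Nat.cast_le.mpr (ncard_le_ncard ?_ (hΓ.finite_inter_Icc _ _))
        intro y hy
        simp only [Finset.coe_filter, mem_ofPred_eq, Finset.mem_filter] at hy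
        exact ⟨hS hy.1.1, hy.1.2, by linarith [hy.2]⟩
      have h3 : ((Λ ∩ Icc x (x + t)).ncard : ℝ) ≤
          (((A.filter (x ≤ ·)).filter (· - x ≤ t)).card : ℝ) := by
        rw [← ncard_coe_finset]
        refine Nat.cast_le.mpr (ncard_le_ncard ?_ (Finset.finite_toSet _))
        intro y hy
        simp only [Finset.coe_filter, mem_ofPred_eq, Finset.mem_filter]
        exact ⟨⟨hAR a ha hxa y hy.1 hy.2.1 (by linarith [hy.2.2, ht.2]), hy.2.1⟩,
          by linarith [hy.2.2]⟩
      have h4 : (Q.natDegree : ℝ) * (((S.filter (x ≤ ·)).filter (· - x ≤ t)).card : ℝ) ≤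
        Q.natDegree * ((Γ ∩ Icc x (x + t)).ncard : ℝ) := by gcongr
      linarith)
    (by
      intro hax t ht
      have h1 := hcount (x - t) x (by linarith [ht.1])
      have h2 : (((S.filter (· < x)).filter (x - · ≤ t)).card : ℝ) ≤
          ((Γ ∩ Icc (x - t) x).ncard : ℝ) := by
        rw [← ncard_coe_finset]
        refine Nat.cast_le.mpr (ncard_le_ncard ?_ (hΓ.finite_inter_Icc _ _))
        intro y hy
        simp only [Finset.coe_filter, mem_ofPred_eq, Finset.mem_filter] at hy
        exact ⟨hS hy.1.1, by linarith [hy.2], hy.1.2.le⟩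
      -- The point `x` may lie in `Λ` but is never a left node; this accounts for the `1` in `C₀ +
      -- 1`.
      have h3 : ((Λ ∩ Icc (x - t) x).ncard : ℝ) ≤
          (((A.filter (· < x)).filter (x - · ≤ t)).card : ℝ) + 1 := by
        rw [← ncard_coe_finset]
        have : (Λ ∩ Icc (x - t) x).ncard ≤
          (insert x (↑((A.filter (· < x)).filter (x - · ≤ t)) : Set ℝ)).ncard := by
          refine ncard_le_ncard ?_ ((Finset.finite_toSet _).insert x)
          intro y hy
          rcases hy.2.2.eq_or_lt with h | h
          · exact Or.inl h
          right
          simp only [Finset.coe_filter, mem_ofPred_eq, Finset.mem_filter]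
          exact ⟨⟨hAL a ha hax y hy.1 (by linarith [hy.2.1, ht.2]) h, h⟩, by linarith [hy.2.1]⟩
        exact_mod_cast this.trans (ncard_insert_le _ _)
      have h4 : (Q.natDegree : ℝ) * (((S.filter (· < x)).filter (x - · ≤ t)).card : ℝ) ≤
        Q.natDegree * ((Γ ∩ Icc (x - t) x).ncard : ℝ) := by gcongr
      linarith)
  have hQprod : ∏ γ ∈ S, ‖Q.eval ((Real.exp (κ * (a - γ)) : ℝ) : ℂ)‖ /
          ‖Q.eval ((Real.exp (κ * (x - γ)) : ℝ) : ℂ)‖ ≤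
      Real.exp (-(κ * (Q.natDegree * ∑ γ ∈ S, (max x γ - max a γ))) +
        CQ * (EΓ + EΓ + 2 * (B * (1 + |x - a|)))) := by
    calc _ ≤ ∏ γ ∈ S, Real.exp (Q.natDegree * κ * (max (a - γ) 0 - max (x - γ) 0) +
          CQ * (Real.exp (-κ * |a - γ|) + Real.exp (-κ * |x - γ|) +
            if (a - γ) * (x - γ) < 0 then 2 else 0)) :=
          Finset.prod_le_prod (fun _ _ => by positivity) fun γ _ => hratio _ _
      _ = Real.exp (-(κ * (Q.natDegree * ∑ γ ∈ S, (max x γ - max a γ))) +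
          CQ * (∑ γ ∈ S, Real.exp (-κ * |a - γ|) + ∑ γ ∈ S, Real.exp (-κ * |x - γ|) +
            2 * ((S.filter fun γ => (a - γ) * (x - γ) < 0).card : ℝ))) := by
          rw [← Real.exp_sum, Finset.sum_add_distrib, ← Finset.mul_sum, ← Finset.mul_sum,
            Finset.sum_add_distrib, Finset.sum_add_distrib, Finset.card_filter]
          congr 2
          · rw [← mul_neg, ← mul_neg, ← Finset.sum_neg_distrib, ← mul_assoc, mul_comm κ]
            congr 1
            refine Finset.sum_congr rfl fun γ _ => ?_
            have : ∀ z : ℝ, max (z - γ) 0 = max z γ - γ := fun z => by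
              rw [← sub_self γ, max_sub_sub_right]
            rw [this, this]; ring
          · push_cast
            rw [Finset.mul_sum]
            congr 2
            refine Finset.sum_congr rfl fun γ _ => ?_
            split_ifs <;> simp
      _ ≤ _ := by
          gcongr
          · exact hexpΓ a S hS
          · exact hexpΓ x S hS
          · have := hcard (min x a) (max x a) (S.filter fun γ => (a - γ) * (x - γ) < 0)
              min_le_max (by
                intro γ hγ
                simp only [Finset.coe_filter, mem_ofPred_eq] at hγ
                refine ⟨hS hγ.1, ?_⟩
                rcases mul_neg_iff.mp hγ.2 with h | h
                · exact ⟨(min_le_left _ _).trans (by linarith), le_max_of_le_right (by linarith)⟩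
                · exact ⟨(min_le_right _ _).trans (by linarith), le_max_of_le_left (by linarith)⟩)
            rwa [max_sub_min_eq_abs, abs_sub_comm] at this
  have hNprod : ∏ b ∈ A.erase a, |Real.exp (κ * x) - Real.exp (κ * b)| /
          |Real.exp (κ * a) - Real.exp (κ * b)| ≤
      Real.exp (κ * ∑ b ∈ A, (max x b - max a b) + K * EΛ) := by
    calc _ ≤ ∏ b ∈ A.erase a, Real.exp (κ * (max x b - max a b) + K * Real.exp (-κ * |a - b|)) := by
          refine Finset.prod_le_prod (fun _ _ => by positivity) fun b hb => ?_
          have hb' := Finset.mem_erase.mp hb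
          exact abs_exp_sub_exp_div_le hκ hδ (hsep a (hAΛ ha) b (hAΛ hb'.2) hb'.1.symm)
      _ = Real.exp (κ * ∑ b ∈ A.erase a, (max x b - max a b) +
          K * ∑ b ∈ A.erase a, Real.exp (-κ * |a - b|)) := by
          rw [← Real.exp_sum, Finset.sum_add_distrib, ← Finset.mul_sum, ← Finset.mul_sum]
      _ ≤ _ := by
          -- The omitted term `b = a` is `max x a - a ≥ 0`.
          have e1 : ∑ b ∈ A.erase a, (max x b - max a b) ≤ ∑ b ∈ A, (max x b - max a b) := by
            rw [← Finset.add_sum_erase A _ ha, max_self]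
            linarith [le_max_right x a]
          have e2 := hexpΛ a (A.erase a) (fun b hb => hAΛ (Finset.mem_of_mem_erase hb))
          exact Real.exp_le_exp.mpr (add_le_add (mul_le_mul_of_nonneg_left e1 hκ.le)
            (mul_le_mul_of_nonneg_left e2 hK0.le))
  have hσ : Real.exp (σ * (x - a)) ≤ Real.exp (|σ| * |x - a|) :=
    Real.exp_le_exp.mpr ((le_abs_self _).trans_eq (abs_mul _ _))
  calc _ ≤ Real.exp (|σ| * |x - a|) *
        Real.exp (-(κ * (Q.natDegree * ∑ γ ∈ S, (max x γ - max a γ))) +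
          CQ * (EΓ + EΓ + 2 * (B * (1 + |x - a|)))) *
        Real.exp (κ * ∑ b ∈ A, (max x b - max a b) + K * EΛ) := by gcongr
    _ ≤ Real.exp ((|σ| + κ * (C₀ + 1) + 2 * CQ * B) * |x - a| +
          (2 * CQ * EΓ + 2 * CQ * B + K * EΛ) - κ * (c / 2) * |x - a| ^ 2) := by
        rw [← Real.exp_add, ← Real.exp_add]
        apply Real.exp_le_exp.mpr
        have := mul_le_mul_of_nonneg_left hexpo hκ.le
        linarith
    _ ≤ _ := hquad _

/-! ### Symmetry of the generator and reduction of the degree -/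

open Polynomial in
theorem HasSymmetryOrder.exists_comp_mul_eq {α : ℝ} (hα : 0 < α) {P Q : ℂ[X]} (hQ : Q ≠ 0) {k : ℕ}
    (h : HasSymmetryOrder α P Q k) : ∃ c : ℂ,
      P.comp (C (Complex.exp (2 * Real.pi * Complex.I / k)) * X) * Q =
        C c * P * Q.comp (C (Complex.exp (2 * Real.pi * Complex.I / k)) * X) := by
  obtain ⟨hk, c, h⟩ := h
  set ζ := Complex.exp (2 * Real.pi * Complex.I / k) with hζ
  have hζ0 : ζ ≠ 0 := Complex.exp_ne_zero _
  have hα' : (α : ℂ) ≠ 0 := by exact_mod_cast hα.ne'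
  have hk' : (k : ℂ) ≠ 0 := by exact_mod_cast (by omega : k ≠ 0)
  refine ⟨c, sub_eq_zero.mp ?_⟩
  have hQζ : Q.comp (C ζ * X) ≠ 0 := by
    intro h0
    rw [comp_eq_zero_iff] at h0
    rcases h0 with h0 | ⟨_, h0⟩
    · exact hQ h0
    · have := congrArg (fun p : ℂ[X] => p.coeff 1) h0
      simp at this
      exact hζ0 this
  -- The extra factor vanishes at `w = 0`, which is not an exponential, and at the poles excluded
  -- from the symmetry relation. The product thus vanishes at every `w`.
  have key : (P.comp (C ζ * X) * Q - C c * P * Q.comp (C ζ * X)) * (Q * Q.comp (C ζ * X) * X) = 0 := by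
    refine Polynomial.funext fun w => ?_
    simp only [eval_mul, eval_sub, eval_comp, eval_C, eval_X, eval_zero]
    by_cases hw : w = 0
    · simp [hw]
    by_cases h1 : Q.eval w = 0
    · simp [h1]
    by_cases h2 : Q.eval (ζ * w) = 0
    · simp [h2]
    have e1 : Complex.exp (α * (Complex.log w / α)) = w := by
      rw [mul_div_cancel₀ _ hα', Complex.exp_log hw]
    have e2 : Complex.exp (α * (Complex.log w / α + 2 * Real.pi * Complex.I / (k * α))) = ζ * w := by
      rw [mul_add, Complex.exp_add, e1, mul_comm, hζ]
      congr 2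
      field_simp
    have h3 := h (Complex.log w / α) (by rwa [e1]) (by rwa [e2])
    rw [generator, generator, e1, e2] at h3
    rw [div_eq_iff h2] at h3
    rw [h3]
    field_simp
    ring
  rcases mul_eq_zero.mp key with h0 | h0
  · exact h0
  · exact absurd h0 (mul_ne_zero (mul_ne_zero hQ hQζ) X_ne_zero)

open Polynomial in
theorem eq_expand_contract {R : ℂ[X]} {k : ℕ} (hk : k ≠ 0) (h : ∀ n, R.coeff n ≠ 0 → k ∣ n) :
    R = expand ℂ k (contract k R) := by
  ext n
  rw [coeff_expand (Nat.pos_of_ne_zero hk), coeff_contract hk]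
  split_ifs with hn
  · rw [Nat.div_mul_cancel hn]
  · by_contra h0
    exact hn (h n h0)

-- With `ζ` a primitive `k`-th root of unity, `P(ζX) Q = c P Q(ζX)`. By coprimality `Q` divides
-- `Q(ζX)`; equal degrees and equal nonzero constant terms give `Q(ζX) = Q`, hence `P(ζX) = c P`. So
-- the exponents in `Q` are multiples of `k`, and those in `P` lie in a single class modulo `k`.
open Polynomial in
theorem IsClassK.exists_eq_expand {α : ℝ} (hα : 0 < α) {P Q : ℂ[X]} (hPQ : IsClassK P Q) {k : ℕ}
    (h : HasSymmetryOrder α P Q k) :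
    ∃ (s : ℕ) (P₁ Q₁ : ℂ[X]), P = X ^ s * expand ℂ k P₁ ∧ Q = expand ℂ k Q₁ := by
  have hQ00 : Q.eval 0 ≠ 0 := by simpa using hPQ.no_zero_nonneg 0 le_rfl
  have hQ0 : Q ≠ 0 := by rintro rfl; simp at hQ00
  have hP0 : P ≠ 0 := by rintro rfl; simpa using hPQ.one_le_deg
  have hk : k ≠ 0 := by have := h.1; omega
  obtain ⟨c, hc⟩ := h.exists_comp_mul_eq hα hQ0
  have hprim := Complex.isPrimitiveRoot_exp k hk
  set ζ := Complex.exp (2 * Real.pi * Complex.I / k) with hζ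
  have hζ0 : ζ ≠ 0 := Complex.exp_ne_zero _
  have hdeg : ∀ R : ℂ[X], (R.comp (C ζ * X)).natDegree = R.natDegree := fun R => by
    rw [natDegree_comp, natDegree_C_mul_X _ hζ0, mul_one]
  have hcop : IsCoprime Q P := by
    refine (isCoprime_iff_aeval_ne_zero_of_isAlgClosed ℂ ℂ Q P).mpr fun a => ?_
    by_contra! hcon
    exact hPQ.no_common_zero a ⟨by simpa using hcon.2, by simpa using hcon.1⟩
  have hcoeff : ∀ (R : ℂ[X]) n, (R.comp (C ζ * X)).coeff n = R.coeff n * ζ ^ n := fun R n =>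
    comp_C_mul_X_coeff
  have hPζ : P.comp (C ζ * X) ≠ 0 := by
    intro h0
    refine hP0 (Polynomial.ext fun n => ?_)
    have := hcoeff P n
    rw [h0, coeff_zero] at this
    simpa [hζ0] using this.symm
  have hc0 : c ≠ 0 := by
    rintro rfl
    simp [hPζ, hQ0] at hc
  have hdvd : Q ∣ Q.comp (C ζ * X) := by
    have h1 : Q ∣ P * (C c * Q.comp (C ζ * X)) := ⟨P.comp (C ζ * X), by rw [mul_comm Q, hc]; ring⟩
    have h2 := hcop.dvd_of_dvd_mul_left h1
    exact (isUnit_C.mpr (isUnit_iff_ne_zero.mpr hc0)).dvd_mul_left.mp h2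
  have hQζ : Q.comp (C ζ * X) = Q := by
    obtain ⟨E, hE⟩ := hdvd
    have hQζ0 : Q.comp (C ζ * X) ≠ 0 := by
      intro h0
      have := hcoeff Q 0
      rw [h0, coeff_zero, pow_zero, mul_one, coeff_zero_eq_eval_zero] at this
      exact hQ00 this.symm
    have hE0 : E ≠ 0 := by rintro rfl; rw [mul_zero] at hE; exact hQζ0 hE
    have hEd : E.natDegree = 0 := by
      have := hdeg Q
      rw [hE, natDegree_mul hQ0 hE0] at this
      omega
    obtain ⟨e, rfl⟩ := natDegree_eq_zero.mp hEd
    have := hcoeff Q 0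
    rw [hE, coeff_mul_C, pow_zero, mul_one, coeff_zero_eq_eval_zero] at this
    rw [hE, mul_left_cancel₀ hQ00 (this.trans (mul_one _).symm), C_1, mul_one]
  have hPc : P.comp (C ζ * X) = C c * P := by
    rw [hQζ] at hc
    exact mul_right_cancel₀ hQ0 hc
  have hQdvd : ∀ n, Q.coeff n ≠ 0 → k ∣ n := fun n hn => by
    have := hcoeff Q n
    rw [hQζ] at this
    exact (hprim.pow_eq_one_iff_dvd n).mp
      (mul_left_cancel₀ hn (this.symm.trans (mul_one _).symm))
  have hPpow : ∀ n, P.coeff n ≠ 0 → ζ ^ n = c := fun n hn => by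
    have := hcoeff P n
    rw [hPc, coeff_C_mul, mul_comm] at this
    exact (mul_left_cancel₀ hn this).symm
  set s := P.natTrailingDegree with hs
  have hsc : ζ ^ s = c := hPpow s (by rw [hs]; exact (trailingCoeff_nonzero_iff_nonzero.mpr hP0))
  have hXP : X ^ s ∣ P := X_pow_dvd_iff.mpr fun d hd => coeff_eq_zero_of_lt_natTrailingDegree hd
  obtain ⟨R, hR⟩ := hXP
  have hRdvd : ∀ n, R.coeff n ≠ 0 → k ∣ n := fun n hn => by
    have h1 : P.coeff (n + s) = R.coeff n := by rw [hR, mul_comm, coeff_mul_X_pow]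
    have h2 := hPpow (n + s) (by rwa [h1])
    rw [pow_add, hsc] at h2
    exact (hprim.pow_eq_one_iff_dvd n).mp (mul_right_cancel₀ hc0 (h2.trans (one_mul c).symm))
  exact ⟨s, contract k R, contract k Q, by rw [← eq_expand_contract hk hRdvd, ← hR],
    eq_expand_contract hk hQdvd⟩

-- The supremum is attained: order `1` is the period of the exponential, and every order divides
-- `deg Q > 0`.
open Polynomial in
theorem IsClassK.hasSymmetryOrder_symmetryOrder {α : ℝ} (hα : 0 < α) {P Q : ℂ[X]}
    (hPQ : IsClassK P Q) : HasSymmetryOrder α P Q (symmetryOrder α P Q) := by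
  refine Nat.sSup_mem (s := {k : ℕ | HasSymmetryOrder α P Q k}) ⟨1, ?_⟩ ⟨Q.natDegree, ?_⟩
  · refine ⟨le_rfl, 1, fun z _ _ => ?_⟩
    have hα' : (α : ℂ) ≠ 0 := by exact_mod_cast hα.ne'
    have : Complex.exp (α * (z + 2 * Real.pi * Complex.I / ((1 : ℕ) * α))) = Complex.exp (α * z) := by
      rw [mul_add, Nat.cast_one, one_mul, mul_div_cancel₀ _ hα', Complex.exp_add,
        Complex.exp_two_pi_mul_I, mul_one]
    rw [generator, generator, this, one_mul]
  · intro k hk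
    obtain ⟨s, P₁, Q₁, -, hQ⟩ := hPQ.exists_eq_expand hα hk
    have h1 : Q.natDegree = Q₁.natDegree * k := by rw [hQ, natDegree_expand]
    exact Nat.le_of_dvd (by have := hPQ.one_le_deg; have := hPQ.deg_lt_deg; omega)
      ⟨Q₁.natDegree, by rw [h1, mul_comm]⟩

open Polynomial in
/-- Substituting `e^{αkx}` for `e^{αx}` brings the generator to lowest terms: the denominator has
degree `q(G) / k(G)`. -/
theorem IsClassK.exists_generator_eq_expRational {α : ℝ} (hα : 0 < α) {P Q : ℂ[X]}
    (hPQ : IsClassK P Q) : ∃ (κ σ : ℝ) (P₁ Q₁ : ℂ[X]), 0 < κ ∧ P₁.natDegree < Q₁.natDegree ∧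
      (∀ x : ℝ, 0 ≤ x → Q₁.eval (x : ℂ) ≠ 0) ∧
      Q.natDegree = Q₁.natDegree * symmetryOrder α P Q ∧ symmetryOrder α P Q ≠ 0 ∧
      ∀ x : ℝ, generator α P Q x = expRational κ σ P₁ Q₁ x := by
  have hsym := hPQ.hasSymmetryOrder_symmetryOrder hα
  set k := symmetryOrder α P Q
  obtain ⟨s, P₁, Q₁, hP, hQ⟩ := hPQ.exists_eq_expand hα hsym
  have hk : k ≠ 0 := by have := hsym.1; omega
  have hQd : Q.natDegree = Q₁.natDegree * k := by rw [hQ, natDegree_expand]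
  -- The factor `X^s` of `P` becomes `e^{sαx}`. A zero `x ≥ 0` of `Q₁` would make its `k`-th root a
  -- nonnegative zero of `Q`.
  refine ⟨k * α, s * α, P₁, Q₁, by positivity, ?_, fun x hx h0 => ?_, hQd, hk, fun x => ?_⟩
  · have hP1 : expand ℂ k P₁ ≠ 0 := by
      intro h0
      have := hPQ.one_le_deg
      rw [hP, h0, mul_zero, natDegree_zero] at this
      omega
    have hPd : P.natDegree = s + P₁.natDegree * k := by
      rw [hP, natDegree_mul (pow_ne_zero _ X_ne_zero) hP1, natDegree_X_pow, natDegree_expand]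
    have := hPQ.deg_lt_deg
    rw [hPd, hQd] at this
    by_contra! hcon
    have := Nat.mul_le_mul_right k hcon
    omega
  · refine hPQ.no_zero_nonneg (x ^ ((k : ℝ)⁻¹)) (Real.rpow_nonneg hx _) ?_
    rw [hQ, expand_eval, ← Complex.ofReal_pow, Real.rpow_inv_natCast_pow hx hk, h0]
  · have e1 : Complex.exp (α * x) = ((Real.exp (α * x) : ℝ) : ℂ) := by push_cast; rfl
    have e2 : ∀ n : ℕ, Real.exp (n * α * x) = Real.exp (α * x) ^ n := fun n => by
      rw [← Real.exp_nat_mul, mul_assoc]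
    rw [generator, e1, expRational, e2, e2, Complex.ofReal_pow, Complex.ofReal_pow]
    conv_lhs => rw [hP, hQ]
    rw [eval_mul, eval_pow, eval_X, expand_eval, expand_eval]

-- At `-∞` the decay comes from `P(0) = 0` and `Q(0) ≠ 0`, at `+∞` from `deg P + 1 ≤ deg Q`.
open Polynomial in
theorem IsClassK.exists_norm_generator_le {α : ℝ} (hα : 0 < α) {P Q : ℂ[X]}
    (hPQ : IsClassK P Q) :
    ∃ C : ℝ, 0 < C ∧ ∀ x : ℝ, ‖generator α P Q x‖ ≤ C * Real.exp (-α * |x|) := by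
  obtain ⟨c₁, hc₁, h₁⟩ := exists_le_norm_eval hPQ.no_zero_nonneg
  obtain ⟨c₂, hc₂, h₂⟩ := exists_le_norm_eval (eval_reverse_ne_zero hPQ.no_zero_nonneg)
  obtain ⟨M₁, hM₁, h₃⟩ := exists_norm_eval_le P.divX
  obtain ⟨M₂, hM₂, h₄⟩ := exists_norm_eval_le P.reverse
  refine ⟨M₁ / c₁ + M₂ / c₂, by positivity, fun x => ?_⟩
  have e1 : Complex.exp (α * x) = ((Real.exp (α * x) : ℝ) : ℂ) := by push_cast; rfl
  have hm := exp_neg_mul_abs_mem hα x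
  rw [generator, e1, norm_div]
  set v := Real.exp (-α * |x|) with hv
  have hv0 : 0 < v := Real.exp_pos _
  rcases le_total x 0 with hx | hx
  · have e2 : Real.exp (α * x) = v := by rw [hv, abs_of_nonpos hx]; congr 1; ring
    have hP : P.eval (v : ℂ) = P.divX.eval (v : ℂ) * v := by
      conv_lhs => rw [← divX_mul_X_add P]
      simp [coeff_zero_eq_eval_zero, hPQ.eval_zero]
    rw [e2, hP, norm_mul, Complex.norm_real, Real.norm_of_nonneg hv0.le]
    calc _ ≤ M₁ * v / c₁ := by gcongr; exacts [h₃ v hm, h₁ v hm]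
      _ = M₁ / c₁ * v + 0 := by ring
      _ ≤ M₁ / c₁ * v + M₂ / c₂ * v := by gcongr; positivity
      _ = _ := by ring
  · rw [norm_eval_exp_of_nonneg P hx, norm_eval_exp_of_nonneg Q hx, ← hv]
    have hd : (P.natDegree : ℝ) + 1 ≤ Q.natDegree := by exact_mod_cast hPQ.deg_lt_deg
    have e3 : Real.exp (P.natDegree * α * max x 0) ≤ Real.exp (Q.natDegree * α * max x 0) * v := by
      rw [hv, ← Real.exp_add, max_eq_left hx, abs_of_nonneg hx]
      apply Real.exp_le_exp.mpr
      nlinarith [mul_nonneg hα.le hx]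
    calc _ ≤ Real.exp (Q.natDegree * α * max x 0) * v * M₂ /
          (Real.exp (Q.natDegree * α * max x 0) * c₂) := by
          gcongr; exacts [h₄ v hm, h₂ v hm]
      _ = M₂ / c₂ * v + 0 := by field_simp; ring
      _ ≤ M₂ / c₂ * v + M₁ / c₁ * v := by gcongr; positivity
      _ = _ := by ring

/-! ### From uniform densities to counts in intervals -/

theorem Separated.encard_inter_Icc {Γ : Set ℝ} (hΓ : Separated Γ) (a b : ℝ) :
    ((Γ ∩ Icc a b).encard : ℝ≥0∞) = ENNReal.ofReal ((Γ ∩ Icc a b).ncard : ℝ) := by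
  rw [← (hΓ.finite_inter_Icc a b).cast_ncard_eq, ENNReal.ofReal_natCast]
  rfl

/-- Both strict density bounds hold on all windows of one fixed length `L`. Tiling an interval by
such windows transfers them to every interval, with a bounded loss at its end. -/
theorem denser_of_density_lt {Γ Λ : Set ℝ} (hΓ : Separated Γ) (hΛ : Separated Λ) {r : ℕ}
    (hr : r ≠ 0) (h : (r : ℝ≥0∞) * upperDensity Γ < lowerDensity Λ) : Denser r Γ Λ := by
  obtain ⟨b', hb1, hb2⟩ := exists_between h
  obtain ⟨a', ha1, ha2⟩ := exists_between hb2
  have hr0 : (r : ℝ≥0∞) ≠ 0 := by exact_mod_cast hr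
  have hrt : (r : ℝ≥0∞) ≠ ∞ := ENNReal.natCast_ne_top r
  have hat : a' ≠ ∞ := ha2.ne_top
  have hbt : b' ≠ ∞ := ha1.ne_top
  have hup : upperDensity Γ < b' / r := by
    rw [ENNReal.lt_div_iff_mul_lt (Or.inl hr0) (Or.inl hrt), mul_comm]
    exact hb1
  have ev1 := eventually_lt_of_lt_liminf (f := atTop) ha2
  have ev2 := eventually_lt_of_limsup_lt (f := atTop) hup
  set β := b'.toReal
  set β' := a'.toReal
  have hββ : β < β' := (ENNReal.toReal_lt_toReal hbt hat).mpr ha1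
  -- With `L = 2R` the lower bound `R ≥ 1 / (β' - β)` gives a surplus of at least `2` per tile: one
  -- unit pays for an endpoint of `Λ` shared by adjacent tiles, the other remains and gives the
  -- slope `1 / L`.
  obtain ⟨R, hR1, hR2, hR3, hR0⟩ := (ev1.and (ev2.and ((eventually_ge_atTop (1 / (β' - β))).and
    (eventually_gt_atTop 0)))).exists
  set L := 2 * R with hL
  have hL0 : 0 < L := by positivity
  have hgap : 2 ≤ (β' - β) * L := by
    rw [div_le_iff₀ (by linarith)] at hR3
    rw [hL]; linarith
  have hΛL : ∀ a, β' * L ≤ ((Λ ∩ Icc a (a + L)).ncard : ℝ) := by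
    intro a
    have h1 := hR1.le.trans (iInf_le _ (a + R))
    rw [hΛ.encard_inter_Icc, ← ENNReal.ofReal_div_of_pos hL0,
      ENNReal.le_ofReal_iff_toReal_le hat (by positivity), le_div_iff₀ hL0] at h1
    rwa [show a + R - R = a by ring, show a + R + R = a + L by rw [hL]; ring] at h1
  have hΓL : ∀ a, r * ((Γ ∩ Icc a (a + L)).ncard : ℝ) ≤ β * L := by
    intro a
    have h1 := (le_iSup (fun x : ℝ => ((Γ ∩ Icc (x - R) (x + R)).encard : ℝ≥0∞) /
      ENNReal.ofReal (2 * R)) (a + R)).trans hR2.le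
    have hr' : (0 : ℝ) < r := by exact_mod_cast Nat.pos_of_ne_zero hr
    rw [hΓ.encard_inter_Icc, ← ENNReal.ofReal_div_of_pos hL0,
      ENNReal.ofReal_le_iff_le_toReal (ENNReal.div_ne_top hbt hr0), div_le_iff₀ hL0,
      ENNReal.toReal_div, ENNReal.toReal_natCast] at h1
    rw [show a + R - R = a by ring, show a + R + R = a + L by rw [hL]; ring] at h1
    calc _ ≤ r * (β / r * L) := by gcongr
      _ = _ := by field_simp
  have hΛM : ∀ (M : ℕ) (a : ℝ), M * (β' * L - 1) ≤ ((Λ ∩ Icc a (a + M * L)).ncard : ℝ) := by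
    intro M
    induction M with
    | zero => intro a; simp
    | succ M ih =>
      intro a
      have h1 := ih (a + L)
      have h2 := hΛL a
      have h3 : (Λ ∩ Icc a (a + L)).ncard ≤ ((Λ ∩ Icc a (a + L)) \ {a + L}).ncard + 1 := by
        have := ncard_le_ncard_sdiff_add_ncard (Λ ∩ Icc a (a + L)) {a + L}
        simpa using this
      have h4 : ((Λ ∩ Icc a (a + L)) \ {a + L}).ncard + (Λ ∩ Icc (a + L) (a + L + M * L)).ncard
          ≤ (Λ ∩ Icc a (a + (M + 1 : ℕ) * L)).ncard := by
        rw [← ncard_union_eq ?_ ((hΛ.finite_inter_Icc _ _).sdiff) (hΛ.finite_inter_Icc _ _)]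
        · refine ncard_le_ncard ?_ (hΛ.finite_inter_Icc _ _)
          have hML : 0 ≤ M * L := by positivity
          rintro y (⟨⟨hy, h5, h6⟩, -⟩ | ⟨hy, h5, h6⟩)
          · exact ⟨hy, h5, by push_cast; linarith⟩
          · exact ⟨hy, by linarith, by push_cast; linarith⟩
        · rw [Set.disjoint_left]
          rintro y ⟨⟨-, -, h6⟩, h7⟩ ⟨-, h8, -⟩
          exact h7 (le_antisymm h6 h8)
      have h3' : ((Λ ∩ Icc a (a + L)).ncard : ℝ) ≤
        (((Λ ∩ Icc a (a + L)) \ {a + L}).ncard : ℝ) + 1 := by exact_mod_cast h3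
      have h4' : (((Λ ∩ Icc a (a + L)) \ {a + L}).ncard : ℝ) +
        ((Λ ∩ Icc (a + L) (a + L + M * L)).ncard : ℝ)
          ≤ ((Λ ∩ Icc a (a + (M + 1 : ℕ) * L)).ncard : ℝ) := by exact_mod_cast h4
      push_cast at h4' ⊢
      linarith
  have hΓM : ∀ (M : ℕ) (a : ℝ),
      r * ((Γ ∩ Icc a (a + (M + 1 : ℕ) * L)).ncard : ℝ) ≤ (M + 1 : ℕ) * (β * L) := by
    intro M
    induction M with
    | zero => intro a; simpa using hΓL a
    | succ M ih =>
      intro a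
      have h1 := ih (a + L)
      have h2 := hΓL a
      have h4 : (Γ ∩ Icc a (a + (M + 1 + 1 : ℕ) * L)).ncard ≤
          (Γ ∩ Icc a (a + L)).ncard + (Γ ∩ Icc (a + L) (a + L + (M + 1 : ℕ) * L)).ncard := by
        refine (ncard_le_ncard ?_ ((hΓ.finite_inter_Icc _ _).union
          (hΓ.finite_inter_Icc _ _))).trans (ncard_union_le _ _)
        rintro y ⟨hy, h5, h6⟩
        rcases le_total y (a + L) with h7 | h7
        · exact Or.inl ⟨hy, h5, h7⟩
        · exact Or.inr ⟨hy, h7, by push_cast at h6 ⊢; linarith⟩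
      have h4' : ((Γ ∩ Icc a (a + (M + 1 + 1 : ℕ) * L)).ncard : ℝ) ≤
          ((Γ ∩ Icc a (a + L)).ncard : ℝ) +
            ((Γ ∩ Icc (a + L) (a + L + (M + 1 : ℕ) * L)).ncard : ℝ) := by exact_mod_cast h4
      have h5 := mul_le_mul_of_nonneg_left h4' (Nat.cast_nonneg (α := ℝ) r)
      calc _ ≤ _ := h5
        _ ≤ β * L + (M + 1 : ℕ) * (β * L) := by rw [mul_add]; gcongr
        _ = _ := by push_cast; ring
  refine ⟨1 / L, β * L + 1, by positivity, fun a b hab => ?_⟩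
  set M := ⌊(b - a) / L⌋₊ with hM
  have hM1 : (M : ℝ) * L ≤ b - a := by
    have := Nat.floor_le (div_nonneg (by linarith : 0 ≤ b - a) hL0.le)
    rwa [← hM, le_div_iff₀ hL0] at this
  have hM2 : b - a ≤ (M + 1 : ℕ) * L := by
    have := Nat.lt_floor_add_one ((b - a) / L)
    rw [← hM, div_lt_iff₀ hL0] at this
    push_cast
    exact this.le
  have h1 := hΛM M a
  have h2 := hΓM M a
  have h3 : ((Λ ∩ Icc a (a + M * L)).ncard : ℝ) ≤ ((Λ ∩ Icc a b).ncard : ℝ) :=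
    Nat.cast_le.mpr (ncard_le_ncard (inter_subset_inter_right _ (Icc_subset_Icc_right
      (by linarith))) (hΛ.finite_inter_Icc _ _))
  have h4 : ((Γ ∩ Icc a b).ncard : ℝ) ≤ ((Γ ∩ Icc a (a + (M + 1 : ℕ) * L)).ncard : ℝ) :=
    Nat.cast_le.mpr (ncard_le_ncard (inter_subset_inter_right _ (Icc_subset_Icc_right
      (by linarith))) (hΓ.finite_inter_Icc _ _))
  have h5 := mul_le_mul_of_nonneg_left h4 (Nat.cast_nonneg (α := ℝ) r)
  have h6 : 1 / L * (b - a) ≤ M + 1 := by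
    rw [one_div, inv_mul_le_iff₀ hL0, mul_comm]
    exact_mod_cast hM2
  have h7 : (M : ℝ) * 2 ≤ M * ((β' - β) * L) := by gcongr
  push_cast at h2 h5
  have h8 : (0 : ℝ) ≤ M := Nat.cast_nonneg M
  linarith

/-! ### Sampling in the mean square norm, reflection and stability -/

theorem integrable_exp_neg_mul_abs {b : ℝ} (hb : 0 < b) :
    Integrable fun x : ℝ => Real.exp (-b * |x|) := by
  rw [← integrableOn_univ, ← Iic_union_Ioi (a := (0 : ℝ))]
  refine IntegrableOn.union ?_ ?_
  · refine (integrableOn_exp_mul_Iic hb 0).congr_fun (fun x hx => ?_) measurableSet_Iic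
    rw [abs_of_nonpos hx]
    simp
  · refine (integrableOn_exp_mul_Ioi (neg_lt_zero.mpr hb) 0).congr_fun (fun x hx => ?_)
      measurableSet_Ioi
    rw [abs_of_pos hx]

/-- Cauchy–Schwarz with the weights `e^{-|x - a|}`. Extending the sum to all of `Λ` removes the
dependence on `A`, which varies with `x`, so that the bound can be integrated. -/
theorem sq_le_of_le_sum_exp {Λ : Set ℝ} {E : ℝ}
    (hE : ∀ (x : ℝ) (F : Finset ℝ), (↑F : Set ℝ) ⊆ Λ → ∑ γ ∈ F, Real.exp (-1 * |x - γ|) ≤ E)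
    {C : ℝ} {f : ℝ → ℂ} {x : ℝ} {A : Finset ℝ} (hA : ↑A ⊆ Λ)
    (h : ‖f x‖ ≤ C * ∑ a ∈ A, Real.exp (-|x - a|) * ‖f a‖) :
    ‖f x‖ₑ ^ 2 ≤ ENNReal.ofReal (C ^ 2 * E) *
      ∑' a : Λ, ENNReal.ofReal (Real.exp (-|x - a|)) * ‖f a‖ₑ ^ 2 := by
  classical
  have hE' := hE x A hA
  simp only [neg_mul, one_mul] at hE'
  have hE0 : 0 ≤ E := (Finset.sum_nonneg fun _ _ => (Real.exp_pos _).le).trans hE'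
  have h1 : (∑ a ∈ A, Real.exp (-|x - a|) * ‖f a‖) ^ 2 ≤
      E * ∑ a ∈ A, Real.exp (-|x - a|) * ‖f a‖ ^ 2 := by
    refine (Finset.sum_sq_le_sum_mul_sum_of_sq_le_mul A (f := fun a => Real.exp (-|x - a|))
      (g := fun a => Real.exp (-|x - a|) * ‖f a‖ ^ 2) (fun _ _ => (Real.exp_pos _).le)
      (fun _ _ => by positivity) (fun a _ => le_of_eq (by ring))).trans ?_
    gcongr
  have h2 : ‖f x‖ ^ 2 ≤ C ^ 2 * E * ∑ a ∈ A, Real.exp (-|x - a|) * ‖f a‖ ^ 2 := by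
    calc ‖f x‖ ^ 2 ≤ (C * ∑ a ∈ A, Real.exp (-|x - a|) * ‖f a‖) ^ 2 := by gcongr
      _ = C ^ 2 * (∑ a ∈ A, Real.exp (-|x - a|) * ‖f a‖) ^ 2 := by ring
      _ ≤ C ^ 2 * (E * ∑ a ∈ A, Real.exp (-|x - a|) * ‖f a‖ ^ 2) := by gcongr
      _ = _ := by ring
  have he : ∀ z : ℂ, ‖z‖ₑ ^ 2 = ENNReal.ofReal (‖z‖ ^ 2) := fun z => by
    rw [ENNReal.ofReal_pow (norm_nonneg _), ofReal_norm]
  rw [he]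
  refine (ENNReal.ofReal_le_ofReal h2).trans ?_
  rw [ENNReal.ofReal_mul (by positivity), ENNReal.ofReal_sum_of_nonneg fun _ _ => by positivity,
    ← Finset.sum_subtype_of_mem (p := (· ∈ Λ)) _ (fun a ha => hA ha)]
  gcongr
  refine le_trans (Finset.sum_le_sum fun a _ => ?_) (ENNReal.sum_le_tsum _)
  rw [ENNReal.ofReal_mul (Real.exp_pos _).le, he]

theorem Separated.exists_lintegral_sq_le {Λ : Set ℝ} (hΛ : Separated Λ) (C : ℝ) :
    ∃ K : ℝ, 0 < K ∧ ∀ f : ℝ → ℂ,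
      (∀ x, ∃ A : Finset ℝ, ↑A ⊆ Λ ∧ ‖f x‖ ≤ C * ∑ a ∈ A, Real.exp (-|x - a|) * ‖f a‖) →
      ∫⁻ x, ‖f x‖ₑ ^ 2 ≤ ENNReal.ofReal K * ∑' a : Λ, ‖f a‖ₑ ^ 2 := by
  obtain ⟨E, hE0, hE⟩ := hΛ.exists_sum_exp_le one_pos
  have := hΛ.countable
  have hI := integrable_exp_neg_mul_abs one_pos
  set I := ∫ x : ℝ, Real.exp (-1 * |x|) with hIdef
  have hI0 : 0 ≤ I := integral_nonneg fun _ => (Real.exp_pos _).le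
  refine ⟨(C ^ 2 * E) * I + 1, by positivity, fun f hf => ?_⟩
  have hint : ∀ a : ℝ, ∫⁻ x, ENNReal.ofReal (Real.exp (-|x - a|)) = ENNReal.ofReal I := by
    intro a
    rw [lintegral_sub_right_eq_self (fun x => ENNReal.ofReal (Real.exp (-|x|))) a, hIdef,
      ofReal_integral_eq_lintegral_ofReal hI (Eventually.of_forall fun _ => (Real.exp_pos _).le)]
    simp
  calc ∫⁻ x, ‖f x‖ₑ ^ 2 ≤ ∫⁻ x, ENNReal.ofReal (C ^ 2 * E) *
        ∑' a : Λ, ENNReal.ofReal (Real.exp (-|x - (a : ℝ)|)) * ‖f a‖ₑ ^ 2 :=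
        lintegral_mono fun x => by
          obtain ⟨A, hA, h⟩ := hf x
          exact sq_le_of_le_sum_exp hE hA h
    _ = ENNReal.ofReal (C ^ 2 * E) * ∑' a : Λ, ENNReal.ofReal I * ‖f a‖ₑ ^ 2 := by
        rw [lintegral_const_mul' _ _ ENNReal.ofReal_ne_top, lintegral_tsum fun a => by fun_prop]
        congr 2
        funext a
        rw [lintegral_mul_const _ (by fun_prop), hint]
    _ = ENNReal.ofReal ((C ^ 2 * E) * I) * ∑' a : Λ, ‖f a‖ₑ ^ 2 := by
        rw [ENNReal.tsum_mul_left, ← mul_assoc, ← ENNReal.ofReal_mul (by positivity)]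
    _ ≤ _ := by gcongr; linarith

theorem integrable_shift_mul_star_shift {g : ℝ → ℂ} (hg : Continuous g) {C α : ℝ} (hα : 0 < α)
    (hdec : ∀ x, ‖g x‖ ≤ C * Real.exp (-α * |x|)) (s t : ℝ) :
    Integrable fun x => g (x - s) * star (g (x - t)) := by
  have hC : 0 ≤ C := by
    have := (norm_nonneg _).trans (hdec 0)
    simpa using this
  refine Integrable.mono' (((integrable_exp_neg_mul_abs hα).comp_sub_right s).const_mul (C * C))
    (by fun_prop) (Eventually.of_forall fun x => ?_)
  rw [norm_mul, norm_star]
  have h1 : ‖g (x - t)‖ ≤ C := (hdec _).trans (by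
    have := (exp_neg_mul_abs_mem hα (x - t)).2
    nlinarith)
  calc _ ≤ C * Real.exp (-α * |x - s|) * C := by gcongr; exact hdec _
    _ = _ := by ring

theorem lintegral_sq_eq_ofReal_re {f : ℝ → ℂ} (hf : Integrable fun x => f x * star (f x)) :
    ∫⁻ x, ‖f x‖ₑ ^ 2 = ENNReal.ofReal (∫ x, f x * star (f x)).re := by
  have h1 : ∀ x, (f x * star (f x)).re = ‖f x‖ ^ 2 := fun x => by
    rw [Complex.star_def, Complex.mul_conj, Complex.normSq_eq_norm_sq, Complex.ofReal_re]
  have h2 : (∫ x, f x * star (f x)).re = ∫ x, (f x * star (f x)).re := (integral_re hf).symm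
  have h3 : Integrable fun x => (f x * star (f x)).re := hf.re
  rw [h2, ofReal_integral_eq_lintegral_ofReal h3
    (Eventually.of_forall fun x => by simp only [h1]; positivity)]
  refine lintegral_congr fun x => ?_
  rw [h1, ENNReal.ofReal_pow (norm_nonneg _), ofReal_norm]

/-- Reflecting the generator transposes the Gram matrix of its shifts. -/
theorem lintegral_sq_sum_reflected_shifts {g : ℝ → ℂ} (hg : Continuous g) {C α : ℝ} (hα : 0 < α)
    (hdec : ∀ x, ‖g x‖ ≤ C * Real.exp (-α * |x|)) {ι : Type*} (S : Finset ι) (p : ι → ℝ)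
    (d : ι → ℂ) :
    ∫⁻ x, ‖∑ i ∈ S, d i * g (p i - x)‖ₑ ^ 2 =
      ∫⁻ x, ‖∑ i ∈ S, star (d i) * g (x - p i)‖ₑ ^ 2 := by
  have hi := integrable_shift_mul_star_shift hg hα hdec
  have hi' : ∀ s t, Integrable fun x => g (s - x) * star (g (t - x)) := fun s t => by
    refine ((hi t s).comp_sub_left (s + t)).congr (Eventually.of_forall fun x => ?_)
    simp only
    rw [show s + t - x - t = s - x by ring, show s + t - x - s = t - x by ring]
  -- The substitution `x ↦ s + t - x` exchanges the roles of `s` and `t`. Conjugating the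
  -- coefficients on the other side compensates for this transposition.
  have hI : ∀ s t, ∫ x, g (s - x) * star (g (t - x)) = ∫ x, g (x - t) * star (g (x - s)) := by
    intro s t
    rw [← integral_sub_left_eq_self (fun x => g (x - t) * star (g (x - s))) volume (s + t)]
    refine integral_congr_ae (Eventually.of_forall fun x => ?_)
    simp only
    rw [show s + t - x - t = s - x by ring, show s + t - x - s = t - x by ring]
  have e1 : ∀ x, (∑ i ∈ S, d i * g (p i - x)) * star (∑ i ∈ S, d i * g (p i - x)) =
      ∑ i ∈ S, ∑ j ∈ S, d i * star (d j) * (g (p i - x) * star (g (p j - x))) := fun x => by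
    rw [star_sum, Finset.sum_mul_sum]
    refine Finset.sum_congr rfl fun i _ => Finset.sum_congr rfl fun j _ => ?_
    rw [star_mul']; ring
  have e2 : ∀ x, (∑ i ∈ S, star (d i) * g (x - p i)) * star (∑ i ∈ S, star (d i) * g (x - p i)) =
      ∑ i ∈ S, ∑ j ∈ S, d j * star (d i) * (g (x - p i) * star (g (x - p j))) := fun x => by
    rw [star_sum, Finset.sum_mul_sum]
    refine Finset.sum_congr rfl fun i _ => Finset.sum_congr rfl fun j _ => ?_
    rw [star_mul', star_star]; ring
  rw [lintegral_sq_eq_ofReal_re, lintegral_sq_eq_ofReal_re]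
  · congr 2
    simp_rw [e1, e2]
    rw [integral_finsetSum _ fun i _ => integrable_finsetSum _ fun j _ => (hi' _ _).const_mul _,
      integral_finsetSum _ fun i _ => integrable_finsetSum _ fun j _ => (hi _ _).const_mul _]
    simp_rw [integral_finsetSum _ fun j _ => (hi' _ _).const_mul _,
      integral_finsetSum _ fun j _ => (hi _ _).const_mul _, integral_const_mul, hI]
    exact Finset.sum_comm
  · simp_rw [e2]
    exact integrable_finsetSum _ fun i _ => integrable_finsetSum _ fun j _ => (hi _ _).const_mul _
  · simp_rw [e1]
    exact integrable_finsetSum _ fun i _ => integrable_finsetSum _ fun j _ => (hi' _ _).const_mul _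

theorem StableShifts.exists_sum_sq_le {G : ℂ → ℂ} {Γ : Set ℝ} (h : StableShifts G Γ) :
    ∃ K : ℝ, 0 < K ∧ ∀ (S : Finset Γ) (d : Γ → ℂ),
      ∑ γ ∈ S, ‖d γ‖ₑ ^ 2 ≤
        ENNReal.ofReal K * ∫⁻ x : ℝ, ‖∑ γ ∈ S, d γ * G ((x - γ : ℝ) : ℂ)‖ₑ ^ 2 := by
  classical
  obtain ⟨C₁, C₂, hC₁, -, hst⟩ := h 2 (by norm_num)
  refine ⟨(C₁ ^ 2)⁻¹, by positivity, fun S d => ?_⟩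
  have h1 := (hst (∑ γ ∈ S, lp.single 2 γ (d γ))).1
  set c : lp (fun _ : Γ => ℂ) 2 := ∑ γ ∈ S, lp.single 2 γ (d γ) with hc
  have hcγ : ∀ γ, c γ = if γ ∈ S then d γ else 0 := fun γ => by
    rw [hc, lp.coeFn_sum, Finset.sum_apply]
    simp only [lp.single_apply]
    simp [Pi.single_apply]
  have hts : ∀ x : ℝ, ∑' γ : Γ, c γ * G ((x - γ : ℝ) : ℂ) =
      ∑ γ ∈ S, d γ * G ((x - γ : ℝ) : ℂ) := fun x => by
    rw [tsum_eq_sum (s := S) fun γ hγ => by rw [hcγ, if_neg hγ, zero_mul]]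
    exact Finset.sum_congr rfl fun γ hγ => by rw [hcγ, if_pos hγ]
  simp_rw [hts] at h1
  rw [eLpNorm_eq_lintegral_rpow_enorm_toReal (by norm_num) (by norm_num)] at h1
  have h2 := pow_le_pow_left' h1 2
  rw [← ENNReal.rpow_natCast, ← ENNReal.rpow_natCast, ← ENNReal.rpow_mul] at h2
  simp only [ENNReal.toReal_ofNat, Nat.cast_ofNat, one_div, ne_eq, OfNat.ofNat_ne_zero,
    not_false_eq_true, inv_mul_cancel₀, ENNReal.rpow_one, ENNReal.rpow_ofNat] at h2
  have h3 : ∑ γ ∈ S, ‖d γ‖ₑ ^ 2 = ENNReal.ofReal (‖c‖ ^ 2) := by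
    have h4 := lp.norm_sum_single (p := 2) (by norm_num) d S
    simp only [ENNReal.toReal_ofNat, Real.rpow_ofNat] at h4
    rw [hc, h4, ENNReal.ofReal_sum_of_nonneg fun _ _ => by positivity]
    refine Finset.sum_congr rfl fun γ _ => ?_
    rw [ENNReal.ofReal_pow (norm_nonneg _), ofReal_norm]
  rw [h3]
  calc ENNReal.ofReal (‖c‖ ^ 2) = ENNReal.ofReal ((C₁ ^ 2)⁻¹) * ENNReal.ofReal (C₁ * ‖c‖) ^ 2 := by
        rw [← ENNReal.ofReal_pow (by positivity), ← ENNReal.ofReal_mul (by positivity)]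
        congr 1
        field_simp
    _ ≤ _ := by gcongr

theorem IsClassK.continuous_generator {α : ℝ} {P Q : Polynomial ℂ} (hPQ : IsClassK P Q) :
    Continuous fun x : ℝ => generator α P Q x := by
  unfold generator
  refine Continuous.div (by fun_prop) (by fun_prop) fun x => ?_
  have : Complex.exp (α * x) = ((Real.exp (α * x) : ℝ) : ℂ) := by push_cast; rfl
  rw [this]
  exact hPQ.no_zero_nonneg _ (Real.exp_pos _).le

/-- Sampling on `Λ` is stable on finite combinations of the reflected shifts of the generator. -/
theorem IsClassK.exists_sum_sq_le_tsum {α : ℝ} (hα : 0 < α) {P Q : Polynomial ℂ}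
    (hPQ : IsClassK P Q) {Γ Λ : Set ℝ} (hΓ : Separated Γ) (hΛ : Separated Λ)
    (hstable : StableShifts (generator α P Q) Γ)
    (hdens : (Q.natDegree : ℝ≥0∞) / (symmetryOrder α P Q : ℝ≥0∞) * upperDensity Γ
      < lowerDensity Λ) :
    ∃ K : ℝ, 0 < K ∧ ∀ (S : Finset Γ) (d : Γ → ℂ),
      ∑ γ ∈ S, ‖d γ‖ₑ ^ 2 ≤ ENNReal.ofReal K *
        ∑' a : Λ, ‖∑ γ ∈ S, d γ * generator α P Q ((γ - a : ℝ) : ℂ)‖ₑ ^ 2 := by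
  classical
  obtain ⟨κ, σ, P₁, Q₁, hκ, hdeg, hQ₁, hQd, hk, hgen⟩ := hPQ.exists_generator_eq_expRational hα
  have hr : (Q.natDegree : ℝ≥0∞) / (symmetryOrder α P Q : ℝ≥0∞) = (Q₁.natDegree : ℝ≥0∞) := by
    rw [hQd, Nat.cast_mul]
    exact ENNReal.mul_div_cancel_right (by exact_mod_cast hk) (ENNReal.natCast_ne_top _)
  rw [hr] at hdens
  have hden := denser_of_density_lt hΓ hΛ (by omega) hdens
  -- Since `γ - x = (-x) - (-γ)`, a sum of reflected shifts is a sum of ordinary shifts over `-Γ`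
  -- evaluated at `-x`; its samples are taken on `-Λ`.
  obtain ⟨C, -, hC⟩ := exists_norm_sum_shifts_le hκ σ hdeg hQ₁ hΓ.neg hΛ.neg hden.neg
  obtain ⟨K₁, hK₁, h₁⟩ := hΛ.exists_lintegral_sq_le C
  obtain ⟨K₂, hK₂, h₂⟩ := hstable.exists_sum_sq_le
  obtain ⟨M, -, hdec⟩ := hPQ.exists_norm_generator_le hα
  refine ⟨K₂ * K₁, by positivity, fun S d => ?_⟩
  have h3 := h₂ S (fun γ => star (d γ))
  rw [← lintegral_sq_sum_reflected_shifts (g := fun x : ℝ => generator α P Q x)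
    hPQ.continuous_generator hα hdec S (fun γ : Γ => (γ : ℝ)) d] at h3
  have hstar : ∀ z : ℂ, ‖star z‖ₑ = ‖z‖ₑ := fun z => by
    rw [← ofReal_norm, norm_star, ofReal_norm]
  simp only [hstar] at h3
  refine h3.trans ?_
  rw [ENNReal.ofReal_mul hK₂.le, mul_assoc]
  gcongr
  refine h₁ (fun x => ∑ γ ∈ S, d γ * generator α P Q ((γ - x : ℝ) : ℂ)) fun x => ?_
  set T : Finset ℝ := S.image fun γ : Γ => -(γ : ℝ) with hT
  set e : ℝ → ℂ := fun y => if h : -y ∈ Γ then d ⟨-y, h⟩ else 0 with he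
  have hf : ∀ y : ℝ, ∑ γ ∈ T, e γ * expRational κ σ P₁ Q₁ (-y - γ) =
      ∑ γ ∈ S, d γ * generator α P Q ((γ - y : ℝ) : ℂ) := fun y => by
    rw [hT, Finset.sum_image fun a _ b _ hab => Subtype.ext (neg_injective hab)]
    refine Finset.sum_congr rfl fun γ _ => ?_
    rw [hgen]
    congr 1
    · simp [he]
    · congr 1; ring
  obtain ⟨A, hAΛ, hA⟩ := hC T e (-x) (by
    intro y hy
    obtain ⟨γ, _, rfl⟩ := Finset.mem_image.mp (Finset.mem_coe.mp hy)
    simp)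
  refine ⟨A.image Neg.neg, ?_, ?_⟩
  · intro y hy
    obtain ⟨a, ha, rfl⟩ := Finset.mem_image.mp (Finset.mem_coe.mp hy)
    exact hAΛ ha
  · rw [hf] at hA
    rw [Finset.sum_image neg_injective.injOn]
    refine hA.trans (le_of_eq ?_)
    congr 1
    refine Finset.sum_congr rfl fun a _ => ?_
    rw [← hf (-a), neg_neg, ← abs_neg, show -(-x - a) = x - -a by ring]

/-! ### Matrices with exponential off-diagonal decay -/

/-- Hölder's inequality for the splitting `w = w^{1 - 1/p} w^{1/p}`. -/
theorem rpow_tsum_mul_le {κ : Type*} {w f : κ → ℝ≥0∞} {W : ℝ≥0∞} (hw : ∑' b, w b ≤ W) {p : ℝ}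
    (hp : 1 ≤ p) : (∑' b, w b * f b) ^ p ≤ W ^ (p - 1) * ∑' b, w b * f b ^ p := by
  have hp0 : 0 < p := by linarith
  have h1 : ∑' b, w b * f b ≤ W ^ (1 - p⁻¹) * (∑' b, w b * f b ^ p) ^ p⁻¹ := by
    rw [ENNReal.tsum_eq_iSup_sum]
    refine iSup_le fun s => (ENNReal.inner_le_weight_mul_Lp_of_nonneg s hp w f).trans ?_
    gcongr
    · have := inv_le_one_of_one_le₀ hp
      linarith
    · exact (ENNReal.sum_le_tsum s).trans hw
    · exact ENNReal.sum_le_tsum s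
  refine (ENNReal.rpow_le_rpow h1 hp0.le).trans (le_of_eq ?_)
  rw [ENNReal.mul_rpow_of_nonneg _ _ hp0.le, ← ENNReal.rpow_mul, ← ENNReal.rpow_mul,
    inv_mul_cancel₀ hp0.ne', ENNReal.rpow_one, sub_mul, inv_mul_cancel₀ hp0.ne', one_mul]

theorem tsum_rpow_tsum_mul_le {ι κ : Type*} {w : ι → κ → ℝ≥0∞} {f : κ → ℝ≥0∞} {W : ℝ≥0∞}
    (hrow : ∀ a, ∑' b, w a b ≤ W) (hcol : ∀ b, ∑' a, w a b ≤ W) {p : ℝ} (hp : 1 ≤ p) :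
    ∑' a, (∑' b, w a b * f b) ^ p ≤ W ^ p * ∑' b, f b ^ p := by
  calc ∑' a, (∑' b, w a b * f b) ^ p ≤ ∑' a, W ^ (p - 1) * ∑' b, w a b * f b ^ p :=
        ENNReal.tsum_le_tsum fun a => rpow_tsum_mul_le (hrow a) hp
    _ = W ^ (p - 1) * ∑' b, (∑' a, w a b) * f b ^ p := by
        rw [ENNReal.tsum_mul_left, ENNReal.tsum_comm]
        simp_rw [ENNReal.tsum_mul_right]
    _ ≤ W ^ (p - 1) * ∑' b, W * f b ^ p := by gcongr with b; exact hcol b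
    _ = W ^ p * ∑' b, f b ^ p := by
        rw [ENNReal.tsum_mul_left, ← mul_assoc]
        congr 1
        conv_lhs => enter [2]; rw [← ENNReal.rpow_one W]
        rw [← ENNReal.rpow_add_of_nonneg _ _ (by linarith) zero_le_one, sub_add_cancel]

/-- The matrix `k`, indexed by points of `A` and `B`, decays exponentially off the diagonal. -/
def ExpDecay {A B : Set ℝ} (β C : ℝ) (k : A → B → ℂ) : Prop :=
  ∀ a b, ‖k a b‖ ≤ C * Real.exp (-β * |(a : ℝ) - b|)

namespace ExpDecay

variable {A B : Set ℝ} {β C : ℝ} {k : A → B → ℂ}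

theorem nonneg_const (hk : ExpDecay β C k) (a : A) (b : B) : 0 ≤ C :=
  nonneg_of_mul_nonneg_left ((norm_nonneg _).trans (hk a b)) (Real.exp_pos _)

theorem norm_mul_le (hk : ExpDecay β C k) {v : B → ℂ} {V : ℝ} (hv : ∀ b, ‖v b‖ ≤ V) (a : A) (b : B) :
    ‖k a b * v b‖ ≤ C * V * Real.exp (-β * |(a : ℝ) - b|) := by
  rw [norm_mul]
  have hC := hk.nonneg_const a b
  calc _ ≤ C * Real.exp (-β * |(a : ℝ) - b|) * V := by gcongr; exacts [hk a b, hv b]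
    _ = _ := by ring

theorem summable_mul (hk : ExpDecay β C k) (hB : Separated B) (hβ : 0 < β) {v : B → ℂ} {V : ℝ}
    (hv : ∀ b, ‖v b‖ ≤ V) (a : A) : Summable fun b => k a b * v b :=
  Summable.of_norm_bounded ((hB.summable_exp hβ (a : ℝ)).mul_left (C * V))
    (hk.norm_mul_le hv a)

/-- Schur's test. -/
theorem exists_tsum_rpow_le (hk : ExpDecay β C k) (hA : Separated A) (hB : Separated B)
    (hβ : 0 < β) : ∃ W : ℝ, 0 ≤ W ∧ ∀ (v : B → ℂ) (p : ℝ), 1 ≤ p →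
      ∑' a, ‖∑' b, k a b * v b‖ₑ ^ p ≤ ENNReal.ofReal W ^ p * ∑' b, ‖v b‖ₑ ^ p := by
  obtain ⟨WA, hWA0, hWA⟩ := hA.exists_tsum_exp_le hβ
  obtain ⟨WB, hWB0, hWB⟩ := hB.exists_tsum_exp_le hβ
  refine ⟨|C| * (WA + WB), by positivity, fun v p hp => ?_⟩
  have hk' : ∀ a b, ‖k a b‖ ≤ |C| * Real.exp (-β * |(a : ℝ) - b|) := fun a b =>
    (hk a b).trans (by gcongr; exact le_abs_self C)
  have hrow : ∀ a : A, ∑' b : B, ENNReal.ofReal (|C| * Real.exp (-β * |(a : ℝ) - b|)) ≤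
      ENNReal.ofReal (|C| * (WA + WB)) := fun a => by
    rw [← ENNReal.ofReal_tsum_of_nonneg (fun _ => by positivity)
      ((hB.summable_exp hβ (a : ℝ)).mul_left _), tsum_mul_left]
    gcongr
    linarith [hWB a]
  have hcol : ∀ b : B, ∑' a : A, ENNReal.ofReal (|C| * Real.exp (-β * |(a : ℝ) - b|)) ≤
      ENNReal.ofReal (|C| * (WA + WB)) := fun b => by
    simp_rw [fun a : A => abs_sub_comm (a : ℝ) b]
    rw [← ENNReal.ofReal_tsum_of_nonneg (fun _ => by positivity)
      ((hA.summable_exp hβ (b : ℝ)).mul_left _), tsum_mul_left]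
    gcongr
    linarith [hWA b]
  refine le_trans (ENNReal.tsum_le_tsum fun a => ?_) (tsum_rpow_tsum_mul_le hrow hcol hp)
  gcongr
  refine enorm_tsum_le_tsum_enorm.trans (ENNReal.tsum_le_tsum fun b => ?_)
  rw [enorm_mul]
  gcongr
  rw [← ofReal_norm]
  exact ENNReal.ofReal_le_ofReal (hk' a b)

theorem memℓp (hk : ExpDecay β C k) (hA : Separated A) (hB : Separated B) (hβ : 0 < β) {p : ℝ≥0∞}
    (hp : 1 ≤ p) (v : lp (fun _ : B => ℂ) p) : Memℓp (fun a => ∑' b, k a b * v b) p := by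
  have hp0 : p ≠ 0 := (zero_lt_one.trans_le hp).ne'
  rcases eq_or_ne p ∞ with rfl | hpt
  · refine memℓp_infty ?_
    obtain ⟨W, hW0, hW⟩ := hB.exists_tsum_exp_le hβ
    refine ⟨|C| * ‖v‖ * W, ?_⟩
    rintro _ ⟨a, rfl⟩
    have hs := (hB.summable_exp hβ (a : ℝ)).mul_left (|C| * ‖v‖)
    refine (tsum_of_norm_bounded hs.hasSum fun b => ?_).trans ?_
    · refine (hk.norm_mul_le (lp.norm_apply_le_norm hp0 v) a b).trans ?_
      gcongr
      exact le_abs_self C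
    · rw [tsum_mul_left]
      gcongr
      exact hW a
  · have hp1 : 1 ≤ p.toReal := by
      rw [← ENNReal.toReal_one]
      exact ENNReal.toReal_mono hpt hp
    have hpos : 0 < p.toReal := by linarith
    obtain ⟨W, hW0, hW⟩ := hk.exists_tsum_rpow_le hA hB hβ
    have he : ∀ z : ℂ, ‖z‖ₑ ^ p.toReal = ENNReal.ofReal (‖z‖ ^ p.toReal) := fun z => by
      rw [← ENNReal.ofReal_rpow_of_nonneg (norm_nonneg _) hpos.le, ofReal_norm]
    have hv : ∑' b, ‖v b‖ₑ ^ p.toReal ≠ ∞ := by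
      simp_rw [he]
      exact (lp.hasSum_norm hpos v).summable.tsum_ofReal_ne_top
    have hne : ∑' a, ‖∑' b, k a b * v b‖ₑ ^ p.toReal ≠ ∞ :=
      ((hW v _ hp1).trans_lt (ENNReal.mul_lt_top
        (ENNReal.rpow_lt_top_of_nonneg hpos.le ENNReal.ofReal_ne_top) hv.lt_top)).ne
    refine memℓp_gen ((ENNReal.summable_toReal hne).congr fun a => ?_)
    rw [he, ENNReal.toReal_ofReal (by positivity)]

/-- By the triangle inequality `η|a - x₀| ≤ η|a - b| + η|b - x₀|`, so rate `η` passes from `v` to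
its image and the remaining rate `β - η` makes the sum over `b` converge. The centre `x₀` is
arbitrary and the constant does not depend on it, so the bound can be iterated. -/
theorem norm_tsum_mul_le (hk : ExpDecay β C k) {η W : ℝ} (hη : 0 < η) (hηβ : η < β)
    (hB : Separated B) (hW : ∀ x : ℝ, ∑' b : B, Real.exp (-(β - η) * |x - b|) ≤ W) {v : B → ℂ}
    {V x₀ : ℝ} (hV : 0 ≤ V) (hv : ∀ b, ‖v b‖ ≤ V * Real.exp (-η * |(b : ℝ) - x₀|)) (a : A) :
    ‖∑' b, k a b * v b‖ ≤ |C| * W * V * Real.exp (-η * |(a : ℝ) - x₀|) := by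
  have hs := (hB.summable_exp (sub_pos.mpr hηβ) (a : ℝ)).mul_left
    (|C| * V * Real.exp (-η * |(a : ℝ) - x₀|))
  refine (tsum_of_norm_bounded hs.hasSum fun b => ?_).trans ?_
  · rw [norm_mul]
    calc ‖k a b‖ * ‖v b‖ ≤ |C| * Real.exp (-β * |(a : ℝ) - b|) *
          (V * Real.exp (-η * |(b : ℝ) - x₀|)) := by
          gcongr
          · refine (hk a b).trans ?_
            gcongr
            exact le_abs_self C
          · exact hv b
      _ = |C| * V * Real.exp (-β * |(a : ℝ) - b| + -η * |(b : ℝ) - x₀|) := by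
          rw [Real.exp_add]; ring
      _ ≤ |C| * V * Real.exp (-η * |(a : ℝ) - x₀| + -(β - η) * |(a : ℝ) - b|) := by
          refine mul_le_mul_of_nonneg_left (Real.exp_le_exp.mpr ?_) (by positivity)
          have := mul_le_mul_of_nonneg_left (abs_sub_le (a : ℝ) b x₀) hη.le
          linarith
      _ = _ := by rw [Real.exp_add]; ring
  · rw [tsum_mul_left]
    calc _ ≤ |C| * V * Real.exp (-η * |(a : ℝ) - x₀|) * W := by gcongr; exact hW a
      _ = _ := by ring

end ExpDecay

/-! ### An exponentially decaying right inverse -/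

theorem enorm_sq_eq_tsum {ι : Type*} (v : lp (fun _ : ι => ℂ) 2) :
    ‖v‖ₑ ^ 2 = ∑' i, ‖v i‖ₑ ^ 2 := by
  have h := lp.hasSum_norm (p := 2) (by norm_num) v
  simp only [ENNReal.toReal_ofNat, Real.rpow_ofNat] at h
  rw [← ofReal_norm, ← ENNReal.ofReal_pow (norm_nonneg _), ← h.tsum_eq,
    ENNReal.ofReal_tsum_of_nonneg (fun _ => by positivity) h.summable]
  refine tsum_congr fun i => ?_
  rw [← ofReal_norm, ← ENNReal.ofReal_pow (norm_nonneg _)]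

theorem ExpDecay.exists_continuousLinearMap {A B : Set ℝ} {β C : ℝ} {k : A → B → ℂ}
    (hk : ExpDecay β C k) (hA : Separated A) (hB : Separated B) (hβ : 0 < β) :
    ∃ T : lp (fun _ : B => ℂ) 2 →L[ℂ] lp (fun _ : A => ℂ) 2,
      ∀ v a, T v a = ∑' b, k a b * v b := by
  obtain ⟨W, hW0, hW⟩ := hk.exists_tsum_rpow_le hA hB hβ
  have hs : ∀ (v : lp (fun _ : B => ℂ) 2) (a : A), Summable fun b => k a b * v b := fun v a =>
    hk.summable_mul hB hβ (lp.norm_apply_le_norm two_ne_zero v) a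
  let T : lp (fun _ : B => ℂ) 2 →ₗ[ℂ] lp (fun _ : A => ℂ) 2 :=
    { toFun := fun v => ⟨fun a => ∑' b, k a b * v b, hk.memℓp hA hB hβ one_le_two v⟩
      map_add' := fun v w => by
        ext a
        change ∑' b, k a b * (v + w) b = ∑' b, k a b * v b + ∑' b, k a b * w b
        rw [← (hs v a).tsum_add (hs w a)]
        refine tsum_congr fun b => ?_
        rw [lp.coeFn_add, Pi.add_apply, mul_add]
      map_smul' := fun c v => by
        ext a
        change ∑' b, k a b * (c • v) b = c • ∑' b, k a b * v b
        rw [smul_eq_mul, ← tsum_mul_left]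
        refine tsum_congr fun b => ?_
        rw [lp.coeFn_smul, Pi.smul_apply, smul_eq_mul]
        ring }
  refine ⟨T.mkContinuous W fun v => ?_, fun v a => rfl⟩
  have h1 : ‖T v‖ₑ ^ 2 ≤ (ENNReal.ofReal W * ‖v‖ₑ) ^ 2 := by
    have := hW v 2 one_le_two
    simp only [ENNReal.rpow_ofNat] at this
    rw [mul_pow, enorm_sq_eq_tsum v, enorm_sq_eq_tsum (T v)]
    exact this
  have h2 := (ENNReal.pow_le_pow_left_iff two_ne_zero).mp h1
  rw [← ofReal_norm, ← ofReal_norm, ← ENNReal.ofReal_mul hW0] at h2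
  exact (ENNReal.ofReal_le_ofReal_iff (by positivity)).mp h2

/-- Expanding the square, `‖v - tTv‖² ≤ (1 - 2tε + t²B²)‖v‖²` for `B ≥ ‖T‖`. The choice `t = ε / B²`
is optimal and gives `1 - (ε / B)²`. -/
theorem exists_norm_sub_smul_le {H : Type*} [NormedAddCommGroup H] [InnerProductSpace ℂ H]
    (T : H →L[ℂ] H) {ε : ℝ} (hε : 0 < ε) (hT : ∀ v, ε * ‖v‖ ^ 2 ≤ (inner ℂ v (T v)).re) :
    ∃ t ρ : ℝ, 0 < t ∧ 0 < ρ ∧ ρ < 1 ∧ ‖(1 : H →L[ℂ] H) - (t : ℂ) • T‖ ≤ ρ := by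
  -- `B` exceeds `ε` as well as `‖T‖`, so that the contraction factor is strictly positive.
  set B := ‖T‖ + 1 + ε with hB
  have hB0 : 0 < B := by positivity
  have hεB : ε / B < 1 := by
    rw [div_lt_one hB0, hB]
    linarith [norm_nonneg T]
  have h0 : 0 < ε / B := by positivity
  have hr0 : 0 < 1 - (ε / B) ^ 2 := by nlinarith
  have hr1 : 1 - (ε / B) ^ 2 < 1 := by nlinarith
  refine ⟨ε / B ^ 2, √(1 - (ε / B) ^ 2), by positivity, Real.sqrt_pos.mpr hr0, ?_, ?_⟩
  · rw [Real.sqrt_lt' one_pos]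
    simpa using hr1
  refine ContinuousLinearMap.opNorm_le_bound _ (Real.sqrt_nonneg _) fun v => ?_
  refine le_of_sq_le_sq ?_ (by positivity)
  rw [mul_pow, Real.sq_sqrt hr0.le]
  have e : ((1 : H →L[ℂ] H) - ((ε / B ^ 2 : ℝ) : ℂ) • T) v = v - ((ε / B ^ 2 : ℝ) : ℂ) • T v := rfl
  have hTv : ‖T v‖ ≤ B * ‖v‖ := (T.le_opNorm v).trans (by gcongr; rw [hB]; linarith)
  have hTv2 : ‖T v‖ ^ 2 ≤ (B * ‖v‖) ^ 2 := by gcongr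
  rw [e, norm_sub_sq (𝕜 := ℂ), inner_smul_right, norm_smul, Complex.norm_real,
    Real.norm_of_nonneg (by positivity)]
  have e2 : RCLike.re (((ε / B ^ 2 : ℝ) : ℂ) * inner ℂ v (T v)) =
      ε / B ^ 2 * (inner ℂ v (T v)).re := Complex.re_ofReal_mul _ _
  rw [e2]
  have h1 : ε / B ^ 2 * (ε * ‖v‖ ^ 2) ≤ ε / B ^ 2 * (inner ℂ v (T v)).re := by
    gcongr; exact hT v
  have h2 : (ε / B ^ 2) ^ 2 * ‖T v‖ ^ 2 ≤ (ε / B ^ 2) ^ 2 * (B * ‖v‖) ^ 2 := by gcongr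
  have h3 : (ε / B ^ 2) ^ 2 * (B * ‖v‖) ^ 2 = (ε / B) ^ 2 * ‖v‖ ^ 2 := by field_simp
  have h4 : ε / B ^ 2 * (ε * ‖v‖ ^ 2) = (ε / B) ^ 2 * ‖v‖ ^ 2 := by field_simp
  rw [mul_pow]
  linarith

/-- The smaller of two bounds is at most their weighted geometric mean. The weight `θ` makes `ρ^{1 -
θ} A^θ = e^{-r/2} < 1` for `r = -log ρ`, so the series still converges and a factor `e^{-θbD}`
survives. -/
theorem exists_norm_le_exp_of_geometric {ρ A b : ℝ} (hρ0 : 0 < ρ) (hρ1 : ρ < 1) (hA : 1 ≤ A)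
    (hb : 0 < b) : ∃ η C : ℝ, 0 < η ∧ η ≤ b ∧ 0 < C ∧ ∀ (D : ℝ) (u : ℕ → ℂ) (z : ℂ), HasSum u z →
      (∀ n, ‖u n‖ ≤ ρ ^ n) → (∀ n, ‖u n‖ ≤ A ^ n * Real.exp (-b * D)) →
      ‖z‖ ≤ C * Real.exp (-η * D) := by
  set r := -Real.log ρ with hr
  set s := Real.log A with hs
  have hr0 : 0 < r := neg_pos.mpr (Real.log_neg hρ0 hρ1)
  have hs0 : 0 ≤ s := Real.log_nonneg hA
  set θ := r / (2 * (r + s)) with hθ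
  have hθ0 : 0 < θ := by positivity
  have hθ1 : θ ≤ 1 := by rw [hθ, div_le_one (by positivity)]; linarith
  have hθr : θ * (r + s) = r / 2 := by rw [hθ]; field_simp
  set q := Real.exp (-(r / 2)) with hq
  have hq0 : 0 ≤ q := (Real.exp_pos _).le
  have hq1 : q < 1 := Real.exp_lt_one_iff.mpr (by linarith)
  refine ⟨θ * b, (1 - q)⁻¹, by positivity, by nlinarith, inv_pos.mpr (by linarith),
    fun D u z hz h1 h2 => ?_⟩
  refine hz.norm_le_of_bounded ((hasSum_geometric_of_lt_one hq0 hq1).mul_right _) fun n => ?_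
  have e1 : ρ ^ n = Real.exp (-r * n) := by
    rw [hr, neg_neg, mul_comm, Real.exp_nat_mul, Real.exp_log hρ0]
  have e2 : A ^ n * Real.exp (-b * D) = Real.exp (s * n - b * D) := by
    rw [sub_eq_add_neg, Real.exp_add, hs, mul_comm (Real.log A), Real.exp_nat_mul,
      Real.exp_log (by linarith), neg_mul]
  have e3 : q ^ n * Real.exp (-(θ * b) * D) =
      Real.exp ((1 - θ) * (-r * n) + θ * (s * n - b * D)) := by
    rw [hq, ← Real.exp_nat_mul, ← Real.exp_add]
    congr 1
    have : (1 - θ) * (-r * n) + θ * (s * n - b * D) = -r * n + θ * (r + s) * n - θ * b * D := by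
      ring
    rw [this, hθr]; ring
  rw [e3]
  rcases le_total (-r * n) (s * n - b * D) with h | h
  · refine ((h1 n).trans_eq e1).trans (Real.exp_le_exp.mpr ?_)
    nlinarith
  · refine ((h2 n).trans_eq e2).trans (Real.exp_le_exp.mpr ?_)
    nlinarith

/-- If the adjoint of an exponentially decaying matrix is bounded below on finite sequences in the
`ℓ²` norm, the matrix has an exponentially decaying right inverse. -/
theorem exists_rightInverse {Γ Λ : Set ℝ} (hΓ : Separated Γ) (hΛ : Separated Λ) {k : Γ → Λ → ℂ}
    {α C K : ℝ} (hα : 0 < α) (hk : ExpDecay α C k) (hK : 0 < K)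
    (hlow : ∀ (S : Finset Γ) (d : Γ → ℂ), ∑ γ ∈ S, ‖d γ‖ₑ ^ 2 ≤
      ENNReal.ofReal K * ∑' a : Λ, ‖∑ γ ∈ S, d γ * k γ a‖ₑ ^ 2) :
    ∃ (η C' : ℝ) (h : Λ → Γ → ℂ), 0 < η ∧ η < α ∧ ExpDecay η C' h ∧
      ∀ γ γ₀, ∑' a, k γ a * h a γ₀ = if γ = γ₀ then 1 else 0 := by
  classical
  have hk' : ExpDecay α C (fun (a : Λ) (γ : Γ) => star (k γ a)) := fun a γ => by
    rw [norm_star, abs_sub_comm]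
    exact hk γ a
  -- `N` is the conjugate transpose of `k`, so its adjoint `M` is the action of `k` on `ℓ²`.
  obtain ⟨N, hN⟩ := hk'.exists_continuousLinearMap hΛ hΓ hα
  set M := ContinuousLinearMap.adjoint N with hM
  have hNsum : ∀ (S : Finset Γ) (d : Γ → ℂ) a,
      N (∑ γ ∈ S, lp.single 2 γ (d γ)) a = star (∑ γ ∈ S, star (d γ) * k γ a) := by
    intro S d a
    rw [hN, star_sum, tsum_eq_sum (s := S)]
    · refine Finset.sum_congr rfl fun γ hγ => ?_
      rw [lp.coeFn_sum, Finset.sum_apply, star_mul', star_star, mul_comm]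
      congr 1
      simp only [lp.single_apply]
      simp [Pi.single_apply, hγ]
    · intro γ hγ
      rw [lp.coeFn_sum, Finset.sum_apply]
      simp only [lp.single_apply]
      simp [Pi.single_apply, hγ]
  have hstar : ∀ z : ℂ, ‖star z‖ₑ = ‖z‖ₑ := fun z => by
    rw [← ofReal_norm, norm_star, ofReal_norm]
  have hNlow : ∀ v, ‖v‖ ≤ √K * ‖N v‖ := by
    intro v
    have hfin : ∀ S : Finset Γ, ‖∑ γ ∈ S, lp.single 2 γ (v γ)‖ ≤
        √K * ‖N (∑ γ ∈ S, lp.single 2 γ (v γ))‖ := by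
      intro S
      have h1 := hlow S (fun γ => star (v γ))
      simp only [hstar] at h1
      have h2 : ∑' a : Λ, ‖∑ γ ∈ S, star (v γ) * k γ a‖ₑ ^ 2 =
          ‖N (∑ γ ∈ S, lp.single 2 γ (v γ))‖ₑ ^ 2 := by
        rw [enorm_sq_eq_tsum]
        refine tsum_congr fun a => ?_
        rw [hNsum, hstar]
      have h3 : ∑ γ ∈ S, ‖v γ‖ₑ ^ 2 = ‖∑ γ ∈ S, lp.single (E := fun _ : Γ => ℂ) 2 γ (v γ)‖ₑ ^ 2 := by
        have h4 := lp.norm_sum_single (p := 2) (by norm_num) (fun γ => v γ) S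
        simp only [ENNReal.toReal_ofNat, Real.rpow_ofNat] at h4
        rw [← ofReal_norm, ← ENNReal.ofReal_pow (norm_nonneg _), h4,
          ENNReal.ofReal_sum_of_nonneg fun _ _ => by positivity]
        refine Finset.sum_congr rfl fun γ _ => ?_
        rw [ENNReal.ofReal_pow (norm_nonneg _), ofReal_norm]
      rw [h2, h3, ← ofReal_norm, ← ofReal_norm, ← ENNReal.ofReal_pow (norm_nonneg _),
        ← ENNReal.ofReal_pow (norm_nonneg _), ← ENNReal.ofReal_mul hK.le,
        ENNReal.ofReal_le_ofReal_iff (by positivity)] at h1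
      refine le_of_sq_le_sq ?_ (by positivity)
      rwa [mul_pow, Real.sq_sqrt hK.le]
    -- Finitely supported sequences are dense in `ℓ²`, and both sides are continuous.
    have hlim := lp.hasSum_single (p := 2) (by norm_num) v
    exact le_of_tendsto_of_tendsto' hlim.norm (((N.continuous.tendsto _).comp hlim).norm.const_mul _)
      hfin
  have hMapply : ∀ w γ, M w γ = ∑' a, k γ a * w a := by
    intro w γ
    have h1 : inner ℂ (lp.single (E := fun _ : Γ => ℂ) 2 γ (1 : ℂ)) (M w) = M w γ := by
      rw [lp.inner_single_left, RCLike.inner_apply, map_one, mul_one]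
    rw [← h1, hM, ContinuousLinearMap.adjoint_inner_right, lp.inner_eq_tsum]
    refine tsum_congr fun a => ?_
    have h2 := hNsum {γ} (fun _ => 1) a
    rw [Finset.sum_singleton, Finset.sum_singleton, star_one, one_mul] at h2
    rw [h2, RCLike.inner_apply, mul_comm]
    simp
  set T := M ∘L N with hT
  have hTlow : ∀ v, K⁻¹ * ‖v‖ ^ 2 ≤ (inner ℂ v (T v)).re := by
    intro v
    have h1 : inner ℂ v (T v) = ((‖N v‖ ^ 2 : ℝ) : ℂ) := by
      rw [hT, ContinuousLinearMap.comp_apply, hM, ContinuousLinearMap.adjoint_inner_right,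
        inner_self_eq_norm_sq_to_K]
      norm_cast
    rw [h1, Complex.ofReal_re, inv_mul_le_iff₀ hK]
    calc ‖v‖ ^ 2 ≤ (√K * ‖N v‖) ^ 2 := by gcongr; exact hNlow v
      _ = _ := by rw [mul_pow, Real.sq_sqrt hK.le]
  obtain ⟨t, ρ, ht, hρ0, hρ1, hE⟩ := exists_norm_sub_smul_le T (inv_pos.mpr hK) hTlow
  set E := (1 : lp (fun _ : Γ => ℂ) 2 →L[ℂ] lp (fun _ : Γ => ℂ) 2) - (t : ℂ) • T with hEdef
  have hE1 : ‖E‖ < 1 := hE.trans_lt hρ1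
  -- Half of the decay rate is propagated; the other half is spent on summability.
  set b := α / 2 with hb
  have hb0 : 0 < b := by positivity
  obtain ⟨WΓ, hWΓ0, hWΓ⟩ := hΓ.exists_tsum_exp_le hb0
  obtain ⟨WΛ, hWΛ0, hWΛ⟩ := hΛ.exists_tsum_exp_le hb0
  have hab : α - b = b := by rw [hb]; ring
  have hNdec : ∀ (v : lp (fun _ : Γ => ℂ) 2) (V x₀ : ℝ), 0 ≤ V →
      (∀ γ : Γ, ‖v γ‖ ≤ V * Real.exp (-b * |(γ : ℝ) - x₀|)) →
      ∀ a : Λ, ‖N v a‖ ≤ |C| * WΓ * V * Real.exp (-b * |(a : ℝ) - x₀|) := by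
    intro v V x₀ hV hv a
    rw [hN]
    exact hk'.norm_tsum_mul_le hb0 (by linarith) hΓ (by rwa [hab]) hV hv a
  have hMdec : ∀ (w : lp (fun _ : Λ => ℂ) 2) (V x₀ : ℝ), 0 ≤ V →
      (∀ a : Λ, ‖w a‖ ≤ V * Real.exp (-b * |(a : ℝ) - x₀|)) →
      ∀ γ : Γ, ‖M w γ‖ ≤ |C| * WΛ * V * Real.exp (-b * |(γ : ℝ) - x₀|) := by
    intro w V x₀ hV hw γ
    rw [hMapply]
    exact hk.norm_tsum_mul_le hb0 (by linarith) hΛ (by rwa [hab]) hV hw γ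
  -- Each application of `E = 1 - tMN` enlarges the exponential envelope by at most the factor `A`,
  -- while the operator norm shrinks by `ρ`. These are the two bounds that
  -- `exists_norm_le_exp_of_geometric` combines.
  set A := 1 + t * (|C| * WΛ * (|C| * WΓ)) with hA
  have hA1 : 1 ≤ A := by rw [hA]; have : 0 ≤ t * (|C| * WΛ * (|C| * WΓ)) := by positivity
                         linarith
  have hEdec : ∀ (γ₀ : Γ) (n : ℕ) (γ : Γ), ‖(E ^ n) (lp.single 2 γ₀ (1 : ℂ)) γ‖ ≤
      A ^ n * Real.exp (-b * |(γ : ℝ) - γ₀|) := by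
    intro γ₀ n
    induction n with
    | zero =>
      intro γ
      rw [pow_zero, pow_zero, one_mul, one_apply_eq_self, lp.single_apply]
      by_cases h : γ = γ₀
      · subst h; simp
      · rw [Pi.single_eq_of_ne h, norm_zero]
        positivity
    | succ n ih =>
      intro γ
      rw [pow_succ', mul_apply_eq_comp]
      set v := (E ^ n) (lp.single 2 γ₀ (1 : ℂ)) with hv
      have e1 : E v γ = v γ - (t : ℂ) * M (N v) γ := rfl
      have h1 := hMdec (N v) _ γ₀ (by positivity) (hNdec v _ γ₀ (by positivity) ih) γ
      rw [e1]
      calc ‖v γ - (t : ℂ) * M (N v) γ‖ ≤ ‖v γ‖ + t * ‖M (N v) γ‖ := by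
            refine (norm_sub_le _ _).trans_eq ?_
            rw [norm_mul, Complex.norm_real, Real.norm_of_nonneg ht.le]
        _ ≤ A ^ n * Real.exp (-b * |(γ : ℝ) - γ₀|) + t * (|C| * WΛ * (|C| * WΓ * A ^ n) *
              Real.exp (-b * |(γ : ℝ) - γ₀|)) := by gcongr; exact ih γ
        _ = _ := by rw [pow_succ]; nth_rewrite 4 [hA]; ring
  have hpow : ∀ (n : ℕ) v, ‖(E ^ n) v‖ ≤ ρ ^ n * ‖v‖ := by
    intro n v
    induction n with
    | zero => simp
    | succ n ih =>
      rw [pow_succ', mul_apply_eq_comp, pow_succ', mul_assoc]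
      exact (E.le_of_opNorm_le hE _).trans (by gcongr)
  obtain ⟨η, C₁, hη, hηb, hC₁, hgeo⟩ := exists_norm_le_exp_of_geometric hρ0 hρ1 hA1 hb0
  set R := ∑' n : ℕ, E ^ n with hR
  have hRsum : HasSum (fun n : ℕ => E ^ n) R := (summable_geometric_of_norm_lt_one hE1).hasSum
  have hRdec : ∀ γ₀ γ : Γ, ‖R (lp.single 2 γ₀ (1 : ℂ)) γ‖ ≤
      C₁ * Real.exp (-η * |(γ : ℝ) - γ₀|) := by
    intro γ₀ γ
    have h1 := hRsum.mapL (ContinuousLinearMap.apply ℂ (lp (fun _ : Γ => ℂ) 2) (lp.single 2 γ₀ (1 : ℂ)))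
    have h2 := h1.mapL (lp.evalCLM ℂ (fun _ : Γ => ℂ) 2 γ)
    refine hgeo _ _ _ h2 (fun n => ?_) (fun n => hEdec γ₀ n γ)
    have h3 : ‖(E ^ n) (lp.single 2 γ₀ (1 : ℂ)) γ‖ ≤ ‖(E ^ n) (lp.single 2 γ₀ (1 : ℂ))‖ :=
      lp.norm_apply_le_norm two_ne_zero _ γ
    refine h3.trans ((hpow n _).trans_eq ?_)
    rw [lp.norm_single (by norm_num), norm_one, mul_one]
  -- Since `1 - E = tT`, the Neumann series `R` of `E` makes `tR` a right inverse of `T = MN`, and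
  -- `N` composed with it is a right inverse of `M`.
  have hTR : ∀ v, T ((t : ℂ) • R v) = v := by
    intro v
    have h1 := mul_neg_geom_series E hE1
    have h2 : (1 : lp (fun _ : Γ => ℂ) 2 →L[ℂ] lp (fun _ : Γ => ℂ) 2) - E = (t : ℂ) • T := by
      rw [hEdef, sub_sub_cancel]
    rw [h2, ← hR] at h1
    have h3 := congrArg (fun F => F v) h1
    rw [map_smul]
    exact h3
  refine ⟨η, |C| * WΓ * (t * C₁), fun a γ₀ => N ((t : ℂ) • R (lp.single 2 γ₀ (1 : ℂ))) a, hη,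
    by linarith, fun a γ₀ => ?_, fun γ γ₀ => ?_⟩
  · change ‖N _ a‖ ≤ _
    rw [hN]
    have hWη : ∀ x : ℝ, ∑' γ : Γ, Real.exp (-(α - η) * |x - γ|) ≤ WΓ := fun x => by
      refine le_trans (Summable.tsum_le_tsum (fun γ => Real.exp_le_exp.mpr ?_)
        (hΓ.summable_exp (by linarith) x) (hΓ.summable_exp hb0 x)) (hWΓ x)
      have : b ≤ α - η := by linarith
      have := mul_le_mul_of_nonneg_right this (abs_nonneg (x - γ))
      linarith
    refine hk'.norm_tsum_mul_le hη (by linarith) hΓ hWη (by positivity) (fun γ => ?_) a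
    rw [lp.coeFn_smul, Pi.smul_apply, norm_smul, Complex.norm_real, Real.norm_of_nonneg ht.le,
      mul_assoc]
    gcongr
    exact hRdec γ₀ γ
  · rw [← hMapply, ← ContinuousLinearMap.comp_apply, ← hT, hTR, lp.single_apply, Pi.single_apply]

/-! ### Solution of the interpolation problem -/

theorem summable_exp_mul_exp {Γ Λ : Set ℝ} (hΓ : Separated Γ) (hΛ : Separated Λ) {α η : ℝ}
    (hα : 0 < α) (hη : 0 < η) (x : ℝ) : Summable fun q : Λ × Γ =>
      Real.exp (-α * |x - (q.1 : ℝ)|) * Real.exp (-η * |(q.1 : ℝ) - (q.2 : ℝ)|) := by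
  obtain ⟨W, hW0, hW⟩ := hΓ.exists_tsum_exp_le hη
  refine (summable_prod_of_nonneg (f := fun q : Λ × Γ =>
      Real.exp (-α * |x - (q.1 : ℝ)|) * Real.exp (-η * |(q.1 : ℝ) - (q.2 : ℝ)|)) ?_).mpr ⟨?_, ?_⟩
  · exact fun q => (mul_pos (Real.exp_pos _) (Real.exp_pos _)).le
  · intro a
    have h := (hΓ.summable_exp hη (a : ℝ)).mul_left (Real.exp (-α * |x - (a : ℝ)|))
    exact h
  · simp only [tsum_mul_left]
    refine Summable.of_nonneg_of_le (fun a => ?_) (fun a => ?_)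
      ((hΛ.summable_exp hα x).mul_right W)
    · exact mul_nonneg (Real.exp_pos _).le (tsum_nonneg fun _ => (Real.exp_pos _).le)
    · exact mul_le_mul_of_nonneg_left (hW a) (Real.exp_pos _).le

/-- Synthesis with an exponentially decaying right inverse solves the interpolation problem. -/
theorem isInterpolationSet_of_rightInverse {Γ Λ : Set ℝ} (hΓ : Separated Γ) (hΛ : Separated Λ)
    {G : ℂ → ℂ} {α η C C' : ℝ} (hα : 0 < α) (hη : 0 < η)
    (hG : ∀ x : ℝ, ‖G x‖ ≤ C * Real.exp (-α * |x|)) {h : Λ → Γ → ℂ} (hh : ExpDecay η C' h)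
    (hinv : ∀ γ γ₀ : Γ, ∑' a : Λ, G ((γ - a : ℝ) : ℂ) * h a γ₀ = if γ = γ₀ then 1 else 0)
    {p : ℝ≥0∞} (hp : 1 ≤ p) : IsInterpolationSet Γ (quasiShiftSpace G Λ p) p := by
  classical
  intro v
  have : Fact (1 ≤ p) := ⟨hp⟩
  have hp0 : p ≠ 0 := (zero_lt_one.trans_le hp).ne'
  have hC : 0 ≤ C := by simpa using (norm_nonneg _).trans (hG 0)
  have hv : ∀ γ, ‖v γ‖ ≤ ‖v‖ := fun γ => lp.norm_apply_le_norm hp0 v γ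
  -- The coefficients are the right inverse applied to the data; the decay of `h` puts them in
  -- `ℓ^p`.
  let c : lp (fun _ : Λ => ℂ) p := ⟨fun a => ∑' γ, h a γ * v γ, hh.memℓp hΛ hΓ hη hp v⟩
  have hcs : ∀ x : ℝ, Summable fun a : Λ => c a * G ((x - a : ℝ) : ℂ) := fun x => by
    refine Summable.of_norm_bounded ((hΛ.summable_exp hα x).mul_left (‖c‖ * C)) fun a => ?_
    rw [norm_mul, mul_assoc]
    exact mul_le_mul (lp.norm_apply_le_norm hp0 c a) (hG _) (norm_nonneg _) (norm_nonneg _)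
  refine ⟨fun x => ∑' a : Λ, c a * G ((x - a : ℝ) : ℂ), ⟨c, fun x => (hcs x).hasSum⟩, fun γ => ?_⟩
  -- Absolute convergence over `Λ × Γ` justifies exchanging the sums, which associativity of the
  -- matrix product needs here: for general `p` the identity for `h` is known only entrywise.
  have hsum : Summable (Function.uncurry fun (a : Λ) (γ₀ : Γ) =>
      G ((γ - a : ℝ) : ℂ) * h a γ₀ * v γ₀) := by
    have hF := (summable_exp_mul_exp hΓ hΛ hα hη (γ : ℝ)).mul_left (C * |C'| * ‖v‖)
    refine Summable.of_norm_bounded hF fun q => ?_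
    rw [Function.uncurry_def, norm_mul, norm_mul]
    have h1 : ‖h q.1 q.2‖ ≤ |C'| * Real.exp (-η * |(q.1 : ℝ) - (q.2 : ℝ)|) :=
      (hh q.1 q.2).trans (by gcongr; exact le_abs_self _)
    calc _ ≤ C * Real.exp (-α * |(γ : ℝ) - (q.1 : ℝ)|) *
          (|C'| * Real.exp (-η * |(q.1 : ℝ) - (q.2 : ℝ)|)) * ‖v‖ := by
          gcongr
          exacts [hG _, hv _]
      _ = _ := by ring
  calc ∑' a : Λ, c a * G ((γ - a : ℝ) : ℂ)
      = ∑' (a : Λ) (γ₀ : Γ), G ((γ - a : ℝ) : ℂ) * h a γ₀ * v γ₀ := by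
        refine tsum_congr fun a => ?_
        change (∑' γ, h a γ * v γ) * G ((γ - a : ℝ) : ℂ) = _
        rw [mul_comm, ← tsum_mul_left]
        exact tsum_congr fun γ₀ => by ring
    _ = ∑' (γ₀ : Γ) (a : Λ), G ((γ - a : ℝ) : ℂ) * h a γ₀ * v γ₀ := hsum.tsum_comm.symm
    _ = ∑' γ₀ : Γ, (if γ = γ₀ then 1 else 0) * v γ₀ := by
        refine tsum_congr fun γ₀ => ?_
        rw [tsum_mul_right, hinv]
    _ = v γ := by
        rw [tsum_eq_single γ fun γ₀ hγ₀ => by rw [if_neg hγ₀.symm, zero_mul], if_pos rfl, one_mul]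

end ShiftInvariant

theorem corollary1p10 (α : ℝ) (hα : 0 < α) (P Q : Polynomial ℂ)
    (hPQ : ShiftInvariant.IsClassK P Q) (Λ Γ : Set ℝ)
    (hΛ : ShiftInvariant.Separated Λ) (hΓ : ShiftInvariant.Separated Γ)
    (hΓd : 0 < ShiftInvariant.lowerDensity Γ)
    (hstable : ShiftInvariant.StableShifts (ShiftInvariant.generator α P Q) Γ)
    (hdens : (Q.natDegree : ℝ≥0∞) / (ShiftInvariant.symmetryOrder α P Q : ℝ≥0∞)
        * ShiftInvariant.upperDensity Γ < ShiftInvariant.lowerDensity Λ) :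
    ∀ p : ℝ≥0∞, 1 ≤ p →
      ShiftInvariant.IsInterpolationSet Γ
        (ShiftInvariant.quasiShiftSpace (ShiftInvariant.generator α P Q) Λ p) p := by
  intro p hp
  obtain ⟨C, -, hdec⟩ := hPQ.exists_norm_generator_le hα
  obtain ⟨K, hK, hlow⟩ := hPQ.exists_sum_sq_le_tsum hα hΓ hΛ hstable hdens
  obtain ⟨η, C', h, hη, -, hh, hinv⟩ := ShiftInvariant.exists_rightInverse hΓ hΛ
    (k := fun γ a => ShiftInvariant.generator α P Q ((γ - a : ℝ) : ℂ)) hα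
    (fun γ a => hdec _) hK hlow
  exact ShiftInvariant.isInterpolationSet_of_rightInverse hΓ hΛ hα hη hdec hh hinv hp
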